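/- Fix TCP CUBIC parameters $C>0$, $\beta\in(0,1)$, a constant round trip time $R>0$ and a packet loss probability $p\in(0,1)$. Window sizes are positive integers (numbers of packets), with no upper bound. For a window size $z\ge 1$ at a loss epoch (just before the reduction) and $d\in\{0,1,2,\dots\}$ RTTs elapsed since that epoch, the window size is $$w(z,d)=\max\Bigl\{1,\ \Bigl\lfloor C\Bigl(Rd-\sqrt[3]{\beta z/C}\Bigr)^3+z\Bigr\rfloor\Bigr\}.$$ The $w(z,d)$ packets sent in an RTT are lost independently with probability $p$. Let $W'_n(p)$ be the window size at the last loss epoch before RTT epoch $n$ and $T_n(p)$ the time, in RTTs, since that epoch. Then $\{(W'_n(p),T_n(p))\}_{n\ge 0}$ is the Markov chain on $\{1,2,\dots\}\times\{0,1,2,\dots\}$ that moves from $(z,d)$ to $(z,d+1)$ with probability $(1-p)^{w(z,d)}$ (no loss) and to $(w(z,d),0)$ with probability $1-(1-p)^{w(z,d)}$ (loss). Define - $W_n(p)=w(W'_n(p),T_n(p))$, the window size at the $n$-th RTT epoch; - $V_k(p)=W_{S_k}(p)$, the window size at the $k$-th loss epoch just after the loss, where $S_0<S_1<\cdots$ are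 the successive times $n\ge 0$ with $T_n(p)=0$ (almost surely there are infinitely many); - $G^p_{V_k(p)}=S_{k+1}-S_k$, the time (in multiples of $R$) between the $k$-th and the $(k+1)$-st loss epoch. For a process $\{X_n\}$ among these, a stationary distribution is a probability distribution $\pi$ such that, for some initial distribution of $(W'_0(p),T_0(p))$, the process $\{X_n\}$ is strictly stationary with one-dimensional marginal law $\pi$. **Corollary.** For every $p\in(0,1)$, each of the processes $\{W_n(p)\}$, $\{V_k(p)\}$ and $\{G^p_{V_k(p)}\}$ has exactly one stationary distribution. -/

import Mathlib

open MeasureTheory ProbabilityTheory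

/-- Window sizes, in packets: positive integers. -/
abbrev Window : Type := {w : ℕ // 1 ≤ w}

/-- States `(z, d)` of the chain `(W'ₙ, Tₙ)`: `z` is the window size at the last drop epoch
(just before the reduction) and `d` is the number of RTTs elapsed since that epoch. -/
abbrev State : Type := Window × ℕ

/-- The CUBIC curve `C (t - (β W₀ / C)^(1/3))³ + W₀`: the window size at time `t` after a loss
epoch at which the window size, just before the reduction, was `W₀`. -/
noncomputable def cubicCurve (C β W₀ t : ℝ) : ℝ :=
  C * (t - (β * W₀ / C) ^ (1 / 3 : ℝ)) ^ 3 + W₀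

/-- The (integer) window size in state `(z, d)`, for round trip time `R`: the integer part of the
CUBIC curve at time `R d`, and at least one packet. -/
noncomputable def windowSize (C β R : ℝ) (s : State) : Window :=
  ⟨max 1 ⌊cubicCurve C β (s.1 : ℕ) (R * s.2)⌋₊, le_max_left _ _⟩

/-- Probability that none of the `w` packets sent in an RTT is lost, when packets are lost
independently with probability `p`. -/
noncomputable def noLossProb (p : unitInterval) (w : Window) : unitInterval :=
  (unitInterval.symm p) ^ (w : ℕ)

/-- One-step transition kernel of `(W'ₙ, Tₙ)`. From `(z, d)`, with current window `w`:
without a loss the next state is `(z, d + 1)`; with a loss it is `(w, 0)`. -/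
noncomputable def stepKernel (C β R : ℝ) (p : unitInterval) : Kernel State State :=
  Kernel.ofFunOfCountable fun s =>
    bernoulliMeasure (s.1, s.2 + 1) (windowSize C β R s, 0) (noLossProb p (windowSize C β R s))

instance stepKernel_isMarkov (C β R : ℝ) (p : unitInterval) :
    IsMarkovKernel (stepKernel C β R p) :=
  ⟨fun s => by
    change IsProbabilityMeasure (bernoulliMeasure _ _ _)
    infer_instance⟩

/-- Law on path space of the Markov chain `(W'ₙ, Tₙ)ₙ` with initial distribution `μ`. -/
noncomputable def chainLaw (C β R : ℝ) (p : unitInterval) (μ : Measure State) :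
    Measure (ℕ → State) :=
  Kernel.trajMeasure (X := fun _ => State) μ fun n =>
    (stepKernel C β R p).comap (fun h => h ⟨n, Finset.mem_Iic.2 le_rfl⟩)
      (measurable_pi_apply _)

/-- `Wₙ`: the window size at the `n`-th RTT epoch. -/
noncomputable def rttWindow (C β R : ℝ) (n : ℕ) (ω : ℕ → State) : Window :=
  windowSize C β R (ω n)

/-- The `k`-th loss epoch, `k = 0, 1, 2, …`: the `k`-th time `n` with `Tₙ = 0`.
(Almost surely there are infinitely many such times.) -/
noncomputable def lossEpoch (k : ℕ) (ω : ℕ → State) : ℕ :=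
  Nat.nth (fun n => (ω n).2 = 0) k

/-- `V_k`: the window size at the `k`-th loss epoch, just after the loss. -/
noncomputable def lossWindow (C β R : ℝ) (k : ℕ) (ω : ℕ → State) : Window :=
  rttWindow C β R (lossEpoch k ω) ω

/-- `G_{V_k}`: the time, in multiples of `R`, between the `k`-th and `(k+1)`-st loss epochs. -/
noncomputable def interLossTime (k : ℕ) (ω : ℕ → State) : ℕ :=
  lossEpoch (k + 1) ω - lossEpoch k ω

/-- A process `X` is (strictly) stationary under `P`: all its time shifts have the same law. -/
def IsStationaryProcess {Ω E : Type*} [MeasurableSpace Ω] [MeasurableSpace E]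
    (X : ℕ → Ω → E) (P : Measure Ω) : Prop :=
  ∀ m : ℕ, IdentDistrib (fun ω n => X (n + m) ω) (fun ω n => X n ω) P P

/-- `π` is a stationary distribution of the process `X`, a functional of the chain
`(W'ₙ, Tₙ)`: for some initial distribution of the chain, `X` is a stationary process whose
one-dimensional marginal law is `π`. -/
def IsStationaryDistribution (C β R : ℝ) (p : unitInterval) {E : Type*} [MeasurableSpace E]
    (X : ℕ → (ℕ → State) → E) (π : Measure E) : Prop :=
  ∃ μ : Measure State, IsProbabilityMeasure μ ∧
    IsStationaryProcess X (chainLaw C β R p μ) ∧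
    ∀ n : ℕ, (chainLaw C β R p μ).map (X n) = π

/-! Each of the three processes has almost surely the form `X k ω = Y (T^[k] (T₀ ω))`, where `T`
carries the path law from an initial law `μ` to the path law from `K ∘ₘ μ`. For the RTT window, `T`
is the shift and `K` is `stepKernel`. For the two loss processes, `T` moves on to the next loss and,
by the strong Markov property (`chainLaw_map_fromFirstLoss`), `K` is the chain of states seen at
losses, `firstLossKernel ∘ₖ stepKernel`. If `K` has an invariant law `π` attracting every initial
law in total variation, then starting from `π` gives a stationary process, and a marginal law that
is the same at all times can only be the one obtained from `π`
(`existsUnique_isStationaryDistribution`).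

Attraction (`exists_isAttracting`) rests on two properties of `K`. One state `a` with a self-loop is
reachable from everywhere, and all orbits of laws are tight. Two tight orbits then keep sending a
fixed fraction of their unmatched mass to `a` at the same time, so their common part grows to full
mass (`exists_larger_common_part`, `exists_common_part`).

Reachability holds because successive losses strictly shrink a window larger than one packet, and a
window of one packet is fixed by a loss (`unitState_accessible`). Tightness comes from a Lyapunov
function with geometric drift (`lyapunov_drift`, `tightOrbit_of_drift`). The drift passes to the
chain of losses by a superharmonic majorant (`lintegral_firstLossKernel_le`,
`exists_isAttracting_lossKernel`). -/

open scoped ENNReal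

/-! ### Path laws as mixtures over the initial state -/

/-- The time shift on paths. -/
def pathShift {S : Type*} (ω : ℕ → S) : ℕ → S := fun n => ω (n + 1)

lemma measurable_pathShift {S : Type*} [MeasurableSpace S] :
    Measurable (pathShift : (ℕ → S) → ℕ → S) := by
  unfold pathShift; fun_prop

instance chainLaw_isProbability (C β R : ℝ) (p : unitInterval) (μ : Measure State)
    [IsProbabilityMeasure μ] : IsProbabilityMeasure (chainLaw C β R p μ) := by
  unfold chainLaw; infer_instance

/-- The law of the chain as a kernel in its initial state. -/
noncomputable def pathKernel (C β R : ℝ) (p : unitInterval) : Kernel State (ℕ → State) :=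
  (Kernel.traj (X := fun _ => State) (fun n =>
    (stepKernel C β R p).comap (fun h => h ⟨n, Finset.mem_Iic.2 le_rfl⟩)
      (measurable_pi_apply _)) 0).comap
    (MeasurableEquiv.piUnique (fun _ : Finset.Iic 0 => State)).symm (MeasurableEquiv.measurable _)

instance (C β R : ℝ) (p : unitInterval) : IsMarkovKernel (pathKernel C β R p) := by
  unfold pathKernel; infer_instance

lemma chainLaw_eq_comp (C β R : ℝ) (p : unitInterval) (μ : Measure State) :
    chainLaw C β R p μ = pathKernel C β R p ∘ₘ μ := by
  ext s hs
  rw [Measure.bind_apply hs (Kernel.aemeasurable _), chainLaw, Kernel.trajMeasure,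
    Measure.bind_apply hs (Kernel.aemeasurable _), lintegral_map (Kernel.measurable_coe _ hs)
      (MeasurableEquiv.measurable _)]
  rfl

lemma chainLaw_dirac (C β R : ℝ) (p : unitInterval) (x : State) :
    chainLaw C β R p (Measure.dirac x) = pathKernel C β R p x := by
  rw [chainLaw_eq_comp, Measure.dirac_bind (Kernel.measurable _)]

/-- Initial segments of paths take countably many values, so atoms determine their laws. Every
finite set of times lies in an initial segment, and projective limits are unique. -/
lemma measure_ext_of_cylinder {S : Type*} [MeasurableSpace S] [Countable S]
    [MeasurableSingletonClass S] {P Q : Measure (ℕ → S)} [IsFiniteMeasure P]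
    (h : ∀ (n : ℕ) (x : ℕ → S), P {ω | ∀ i ≤ n, ω i = x i} = Q {ω | ∀ i ≤ n, ω i = x i}) :
    P = Q := by
  have key : ∀ n, P.map (Preorder.frestrictLe n) = Q.map (Preorder.frestrictLe n) := by
    intro n
    refine Measure.ext_of_singleton fun y => ?_
    have hx : ∃ x : ℕ → S, Preorder.frestrictLe n x = y :=
      ⟨fun i => if hi : i ≤ n then y ⟨i, Finset.mem_Iic.2 hi⟩ else y ⟨0, Finset.mem_Iic.2 (Nat.zero_le _)⟩,
        by ext ⟨i, hi⟩; simp [Finset.mem_Iic.1 hi]⟩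
    obtain ⟨x, rfl⟩ := hx
    rw [Measure.map_apply (by fun_prop) (measurableSet_singleton _),
      Measure.map_apply (by fun_prop) (measurableSet_singleton _)]
    have hset : (Preorder.frestrictLe n : (ℕ → S) → _) ⁻¹' {Preorder.frestrictLe n x} =
        {ω | ∀ i ≤ n, ω i = x i} := by
      ext ω
      simp [funext_iff]
    rw [hset, h]
  have hP : IsProjectiveLimit P (fun I : Finset ℕ => P.map I.restrict) := fun I => rfl
  refine hP.unique (P := fun I : Finset ℕ => P.map I.restrict) ?_
  intro I
  have hI := I.subset_Iic_sup_id
  show Q.map I.restrict = P.map I.restrict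
  rw [← Finset.restrict₂_comp_restrict hI, ← Measure.map_map (by fun_prop) (by fun_prop),
    ← Measure.map_map (by fun_prop) (by fun_prop)]
  exact congrArg _ (key _).symm

/-! ### Markov property, and strong Markov property at the first loss -/

section Paths

variable {C β R : ℝ} {p : unitInterval} {μ : Measure State}

lemma chainLaw_map_zero : (chainLaw C β R p μ).map (fun ω => ω 0) = μ := by
  have h : ∀ x, (pathKernel C β R p x).map (fun ω => ω 0) = Measure.dirac x := by
    intro x
    have h1 := Kernel.traj_map_frestrictLe_apply (X := fun _ => State) (κ := fun n =>
      (stepKernel C β R p).comap (fun h => h ⟨n, Finset.mem_Iic.2 le_rfl⟩)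
        (measurable_pi_apply _)) 0 0 ((MeasurableEquiv.piUnique
          (fun _ : Finset.Iic 0 => State)).symm x)
    rw [Kernel.partialTraj_self, Kernel.id_apply] at h1
    have h2 := congrArg (fun ν => ν.map (fun y : Finset.Iic 0 → State =>
      y ⟨0, Finset.mem_Iic.2 le_rfl⟩)) h1
    rw [Measure.map_map (measurable_pi_apply _) (by fun_prop),
      Measure.map_dirac' (measurable_pi_apply _)] at h2
    exact h2
  rw [chainLaw_eq_comp, Measure.map_comp _ _ (by fun_prop)]
  refine Measure.ext fun s hs => ?_
  rw [Measure.bind_apply hs (Kernel.aemeasurable _)]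
  simp_rw [Kernel.map_apply _ (show Measurable (fun ω : ℕ → State => ω 0) by fun_prop), h,
    Measure.dirac_apply' _ hs]
  rw [lintegral_indicator_one hs]

variable [IsProbabilityMeasure μ]

lemma chainLaw_step {n : ℕ} {A : Set (Π _ : Finset.Iic n, State)} (hA : MeasurableSet A) (B : Set State) :
    chainLaw C β R p μ {ω | Preorder.frestrictLe n ω ∈ A ∧ ω (n + 1) ∈ B} =
      ∫⁻ ω in {ω | Preorder.frestrictLe n ω ∈ A}, stepKernel C β R p (ω n) B
        ∂(chainLaw C β R p μ) := by
  have h := Kernel.map_frestrictLe_trajMeasure_compProd_eq_map_trajMeasure (X := fun _ => State)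
    (μ₀ := μ) (κ := fun n => (stepKernel C β R p).comap (fun h => h ⟨n, Finset.mem_Iic.2 le_rfl⟩)
      (measurable_pi_apply _)) (a := n)
  have h2 := congrArg (fun ν => ν (A ×ˢ B)) h
  rw [Measure.compProd_apply_prod hA .of_discrete,
    Measure.map_apply (by fun_prop) (hA.prod .of_discrete),
    Measure.restrict_map (by fun_prop) hA, lintegral_map (Kernel.measurable_coe _ .of_discrete) (by fun_prop)] at h2
  exact h2.symm

lemma chainLaw_step_of_eq {n : ℕ} {A : Set (Π _ : Finset.Iic n, State)} (hA : MeasurableSet A)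
    (B : Set State) (x : State) (hx : ∀ y ∈ A, y ⟨n, Finset.mem_Iic.2 le_rfl⟩ = x) :
    chainLaw C β R p μ {ω | Preorder.frestrictLe n ω ∈ A ∧ ω (n + 1) ∈ B} =
      chainLaw C β R p μ {ω | Preorder.frestrictLe n ω ∈ A} * stepKernel C β R p x B := by
  rw [chainLaw_step hA, setLIntegral_congr_fun (g := fun _ => stepKernel C β R p x B), setLIntegral_const, mul_comm]
  · exact measurableSet_preimage (Preorder.measurable_frestrictLe n) hA
  · intro ω hω
    simp only
    rw [← hx _ hω]; rfl

/-- Both laws agree on cylinders by induction on the length: prescribing one more state multiplies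
each side by the same transition probability. -/
lemma chainLaw_map_shift :
    (chainLaw C β R p μ).map pathShift = chainLaw C β R p (stepKernel C β R p ∘ₘ μ) := by
  have : IsProbabilityMeasure ((chainLaw C β R p μ).map pathShift) :=
    Measure.isProbabilityMeasure_map measurable_pathShift.aemeasurable
  have hcyl : ∀ (n : ℕ) (x : ℕ → State), MeasurableSet {ω : ℕ → State | ∀ i ≤ n, ω i = x i} := by
    intro n x
    have : {ω : ℕ → State | ∀ i ≤ n, ω i = x i} = ⋂ i, ⋂ (_ : i ≤ n), (fun ω => ω i) ⁻¹' {x i} := by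
      ext; simp
    rw [this]
    exact .iInter fun i => .iInter fun _ => measurable_pi_apply i (measurableSet_singleton _)
  refine measure_ext_of_cylinder fun n x => ?_
  rw [Measure.map_apply measurable_pathShift (hcyl n x)]
  induction n with
  | zero =>
    have h0 : chainLaw C β R p (stepKernel C β R p ∘ₘ μ) {ω | ∀ i ≤ 0, ω i = x i} =
        (stepKernel C β R p ∘ₘ μ) {x 0} := by
      conv_rhs => rw [← chainLaw_map_zero (C := C) (β := β) (R := R) (p := p)
        (μ := stepKernel C β R p ∘ₘ μ)]
      rw [Measure.map_apply (by fun_prop) (measurableSet_singleton _)]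
      congr 1; ext; simp
    rw [h0]
    have h1 := chainLaw_step (C := C) (β := β) (R := R) (p := p) (μ := μ) (n := 0) .univ {x 0}
    have h2 : pathShift ⁻¹' {ω : ℕ → State | ∀ i ≤ 0, ω i = x i} =
        {ω | Preorder.frestrictLe (π := fun _ => State) 0 ω ∈ Set.univ ∧ ω (0 + 1) ∈ ({x 0} : Set State)} := by
      ext ω; simp [pathShift]
    rw [h2, h1, Measure.bind_apply (measurableSet_singleton _) (Kernel.aemeasurable _)]
    simp only [Set.mem_univ, Set.ofPred_true, Measure.restrict_univ]
    conv_rhs => rw [← chainLaw_map_zero (C := C) (β := β) (R := R) (p := p) (μ := μ)]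
    rw [lintegral_map (Kernel.measurable_coe _ (measurableSet_singleton _)) (by fun_prop)]
  | succ n ih =>
    have hA : ∀ (n : ℕ) (x : ℕ → State) (ν : Measure State) [IsProbabilityMeasure ν],
        chainLaw C β R p ν {ω | ∀ i ≤ n + 1, ω i = x i} =
        chainLaw C β R p ν {ω | ∀ i ≤ n, ω i = x i} * stepKernel C β R p (x n) {x (n + 1)} := by
      intro n x ν _
      have := chainLaw_step_of_eq (C := C) (β := β) (R := R) (p := p) (μ := ν) (n := n)
        (A := {y | ∀ i, y i = x i}) .of_discrete {x (n + 1)} (x n) (fun y hy => hy _)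
      convert this using 3
      · ext ω
        simp [Nat.le_succ_iff_eq_or_le, or_imp, forall_and, and_comm]
      · ext ω; simp
    have h2 : chainLaw C β R p μ (pathShift ⁻¹' {ω | ∀ i ≤ n + 1, ω i = x i}) =
        chainLaw C β R p μ (pathShift ⁻¹' {ω | ∀ i ≤ n, ω i = x i}) *
          stepKernel C β R p (x n) {x (n + 1)} := by
      have := chainLaw_step_of_eq (C := C) (β := β) (R := R) (p := p) (μ := μ) (n := n + 1)
        (A := {y | ∀ i, ∀ hi : i ≤ n, y ⟨i + 1, Finset.mem_Iic.2 (by omega)⟩ = x i})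
        .of_discrete {x (n + 1)} (x n) (fun y hy => hy _ le_rfl)
      convert this using 3
      · ext ω
        simp [Nat.le_succ_iff_eq_or_le, or_imp, forall_and, and_comm, pathShift]
      · ext ω
        simp [pathShift]
    rw [h2, ih, hA]

lemma ae_pathKernel_zero (x : State) : ∀ᵐ ω ∂pathKernel C β R p x, ω 0 = x := by
  have h := chainLaw_map_zero (C := C) (β := β) (R := R) (p := p) (μ := Measure.dirac x)
  rw [chainLaw_dirac] at h
  have h2 : ∀ᵐ y ∂((pathKernel C β R p x).map fun ω => ω 0), y = x := by
    rw [h]; simp [ae_dirac_eq]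
  exact ae_of_ae_map (measurable_pi_apply 0).aemeasurable h2

lemma lintegral_pathKernel_shift (x : State) {F : (ℕ → State) → ℝ≥0∞} (hF : Measurable F) :
    ∫⁻ ω, F (pathShift ω) ∂pathKernel C β R p x =
      ∫⁻ y, ∫⁻ ω, F ω ∂pathKernel C β R p y ∂stepKernel C β R p x := by
  rw [← chainLaw_dirac, ← lintegral_map hF measurable_pathShift, chainLaw_map_shift,
    chainLaw_eq_comp, Measure.lintegral_bind (Kernel.aemeasurable _) hF.aemeasurable,
    Measure.dirac_bind (Kernel.measurable _)]

lemma lintegral_stepKernel (x : State) (f : State → ℝ≥0∞) :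
    ∫⁻ y, f y ∂stepKernel C β R p x =
      ENNReal.ofReal ((1 - p : ℝ) ^ (windowSize C β R x : ℕ)) * f (x.1, x.2 + 1) +
      ENNReal.ofReal (1 - (1 - p : ℝ) ^ (windowSize C β R x : ℕ)) *
        f (windowSize C β R x, 0) := by
  change ∫⁻ y, f y ∂(bernoulliMeasure _ _ _) = _
  rw [bernoulliMeasure_def, lintegral_add_measure]
  simp only [lintegral_smul_measure, lintegral_dirac]
  congr 1
  · rw [ENNReal.smul_def, smul_eq_mul, ENNReal.ofReal]
    congr 2
    rw [← NNReal.coe_inj, Real.coe_toNNReal]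
    · simp [noLossProb]
    · exact pow_nonneg (by linarith [p.2.2]) _
  · rw [ENNReal.smul_def, smul_eq_mul, ENNReal.ofReal]
    congr 2
    rw [← NNReal.coe_inj, Real.coe_toNNReal]
    · simp [noLossProb]
    · have := pow_le_one₀ (n := (windowSize C β R x : ℕ)) (show (0:ℝ) ≤ 1 - p by linarith [p.2.2])
        (by linarith [p.2.1])
      linarith

lemma stepKernel_apply (x : State) (B : Set State) :
    stepKernel C β R p x B =
      ENNReal.ofReal ((1 - p : ℝ) ^ (windowSize C β R x : ℕ)) * B.indicator 1 (x.1, x.2 + 1) +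
      ENNReal.ofReal (1 - (1 - p : ℝ) ^ (windowSize C β R x : ℕ)) *
        B.indicator 1 (windowSize C β R x, 0) := by
  rw [← lintegral_stepKernel, lintegral_indicator_one .of_discrete]

lemma noLoss_le (x : State) : (1 - p : ℝ) ^ (windowSize C β R x : ℕ) ≤ 1 - p :=
  pow_le_of_le_one (by linarith [p.2.2]) (by linarith [p.2.1])
    (Nat.one_le_iff_ne_zero.1 (windowSize C β R x).2)

lemma stepKernel_noLoss_le (x : State) :
    stepKernel C β R p x {y | y.2 ≠ 0} ≤ ENNReal.ofReal (1 - p) := by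
  rw [stepKernel_apply]
  simpa using ENNReal.ofReal_le_ofReal (noLoss_le x)

lemma le_stepKernel_loss (x : State) :
    ENNReal.ofReal p ≤ stepKernel C β R p x {(windowSize C β R x, 0)} := by
  rw [stepKernel_apply]
  simpa using ENNReal.ofReal_le_ofReal (show (p : ℝ) ≤ _ by linarith [noLoss_le (C := C) (β := β) (R := R) (p := p) x])

/-- The paths whose first loss epoch is `n`. -/
def firstLossAt (n : ℕ) : Set (ℕ → State) := {ω | (∀ i < n, (ω i).2 ≠ 0) ∧ (ω n).2 = 0}

lemma measurableSet_firstLossAt (n : ℕ) : MeasurableSet (firstLossAt n) := by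
  have : firstLossAt n = (⋂ i, ⋂ (_ : i < n), (fun ω : ℕ → State => ω i) ⁻¹' {y | y.2 ≠ 0}) ∩
      (fun ω : ℕ → State => ω n) ⁻¹' {y | y.2 = 0} := by
    ext; simp [firstLossAt]
  rw [this]
  exact (MeasurableSet.iInter fun i => .iInter fun _ => measurable_pi_apply i .of_discrete).inter
    (measurable_pi_apply n .of_discrete)

lemma firstLossAt_disjoint : Pairwise (Function.onFun Disjoint firstLossAt) := by
  intro m n hmn
  refine Set.disjoint_left.2 fun ω hm hn => ?_
  rcases lt_or_gt_of_ne hmn with h | h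
  · exact hn.1 m h hm.2
  · exact hm.1 n h hn.2

lemma iUnion_firstLossAt : ⋃ n, firstLossAt n = {ω | ∃ n, (ω n).2 = 0} := by
  ext ω
  simp only [Set.mem_iUnion, Set.mem_ofPred_eq]
  refine ⟨fun ⟨n, hn⟩ => ⟨n, hn.2⟩, fun h => ?_⟩
  classical
  exact ⟨Nat.find h, fun i hi => Nat.find_min h hi, Nat.find_spec h⟩

lemma lossEpoch_zero_of_mem {n : ℕ} {ω : ℕ → State} (h : ω ∈ firstLossAt n) :
    lossEpoch 0 ω = n := by
  classical
  rw [lossEpoch, Nat.nth_zero]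
  exact le_antisymm (Nat.sInf_le h.2) (le_csInf ⟨n, h.2⟩ fun i hi => not_lt.1 fun hlt => h.1 i hlt hi)

/-- At least one packet is sent per RTT, so each step avoids a loss with probability at most `1 -
p`, whatever the state. -/
lemma ae_exists_loss (hp0 : 0 < p) : ∀ᵐ ω ∂chainLaw C β R p μ, ∃ n, (ω n).2 = 0 := by
  have key : ∀ N : ℕ, chainLaw C β R p μ {ω | ∀ i ≤ N, (ω i).2 ≠ 0} ≤
      ENNReal.ofReal (1 - p) ^ N := by
    intro N
    induction N with
    | zero => simpa using prob_le_one
    | succ N ih =>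
      have h := chainLaw_step (C := C) (β := β) (R := R) (p := p) (μ := μ) (n := N)
        (A := {y | ∀ i, (y i).2 ≠ 0}) .of_discrete {y | y.2 ≠ 0}
      have e1 : {ω : ℕ → State | ∀ i ≤ N + 1, (ω i).2 ≠ 0} =
          {ω | Preorder.frestrictLe (π := fun _ => State) N ω ∈
            {y : Finset.Iic N → State | ∀ i, (y i).2 ≠ 0} ∧ ω (N + 1) ∈ {y : State | y.2 ≠ 0}} := by
        ext ω
        simp [Nat.le_succ_iff_eq_or_le, or_imp, forall_and, and_comm]
      have e2 : {ω : ℕ → State | ∀ i ≤ N, (ω i).2 ≠ 0} =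
          {ω | Preorder.frestrictLe (π := fun _ => State) N ω ∈
            {y : Finset.Iic N → State | ∀ i, (y i).2 ≠ 0}} := by
        ext ω
        simp
      rw [e1, h, ← e2, pow_succ']
      calc _ ≤ ∫⁻ ω in {ω | ∀ i ≤ N, (ω i).2 ≠ 0}, ENNReal.ofReal (1 - p) ∂chainLaw C β R p μ :=
            lintegral_mono fun ω => stepKernel_noLoss_le _
        _ ≤ _ := by
          rw [setLIntegral_const]
          gcongr
  rw [ae_iff]
  refine le_antisymm (ge_of_tendsto' (ENNReal.tendsto_pow_atTop_nhds_zero_of_lt_one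
    (r := ENNReal.ofReal (1 - p)) ?_) fun N => ?_) (zero_le)
  · rw [ENNReal.ofReal_lt_one]
    have : (0 : ℝ) < p := hp0
    linarith
  · refine le_trans (measure_mono ?_) (key N)
    intro ω hω i _
    simp only [not_exists, Set.mem_ofPred_eq] at hω
    exact hω i

lemma ae_mem_iUnion_firstLossAt (hp0 : 0 < p) :
    ∀ᵐ ω ∂chainLaw C β R p μ, ω ∈ ⋃ n, firstLossAt n := by
  rw [iUnion_firstLossAt]; exact ae_exists_loss hp0

lemma lintegral_eq_tsum_firstLossAt (hp0 : 0 < p) (F : (ℕ → State) → ℝ≥0∞) :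
    ∫⁻ ω, F ω ∂chainLaw C β R p μ = ∑' n, ∫⁻ ω in firstLossAt n, F ω ∂chainLaw C β R p μ := by
  rw [← lintegral_iUnion measurableSet_firstLossAt firstLossAt_disjoint,
    Measure.restrict_eq_self_of_ae_mem (ae_mem_iUnion_firstLossAt hp0)]

lemma setLIntegral_firstLossAt_zero (x : State) (F : (ℕ → State) → ℝ≥0∞) :
    ∫⁻ ω in firstLossAt 0, F ω ∂pathKernel C β R p x =
      if x.2 = 0 then ∫⁻ ω, F ω ∂pathKernel C β R p x else 0 := by
  split_ifs with hx
  · rw [Measure.restrict_eq_self_of_ae_mem]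
    filter_upwards [ae_pathKernel_zero x] with ω hω
    simp [firstLossAt, hω, hx]
  · rw [Measure.restrict_eq_zero.2, lintegral_zero_measure]
    refine measure_mono_null ?_ (ae_iff.1 (ae_pathKernel_zero x))
    intro ω hω h
    simp [firstLossAt, h, hx] at hω

/-- First-step analysis. Starting at a loss, the first loss epoch is `0`, which accounts for the
zero branch. -/
lemma setLIntegral_firstLossAt_succ (x : State) (n : ℕ) {F : (ℕ → State) → ℝ≥0∞}
    (hF : Measurable F) :
    ∫⁻ ω in firstLossAt (n + 1), F (pathShift ω) ∂pathKernel C β R p x =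
      if x.2 = 0 then 0 else
        ∫⁻ y, ∫⁻ ω in firstLossAt n, F ω ∂pathKernel C β R p y ∂stepKernel C β R p x := by
  split_ifs with hx
  · rw [Measure.restrict_eq_zero.2, lintegral_zero_measure]
    refine measure_mono_null ?_ (ae_iff.1 (ae_pathKernel_zero x))
    intro ω hω h
    exact hω.1 0 (Nat.succ_pos _) (by rw [h, hx])
  · simp_rw [← lintegral_indicator (measurableSet_firstLossAt _)]
    rw [← lintegral_pathKernel_shift x (hF.indicator (measurableSet_firstLossAt n))]
    refine lintegral_congr_ae ?_
    filter_upwards [ae_pathKernel_zero x] with ω hω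
    have : ω ∈ firstLossAt (n + 1) ↔ pathShift ω ∈ firstLossAt n := by
      simp only [firstLossAt, Set.mem_ofPred_eq, pathShift]
      refine and_congr_left fun _ => ⟨fun h i hi => h _ (by omega), fun h i hi => ?_⟩
      cases i with
      | zero => rwa [hω]
      | succ i => exact h i (by omega)
    by_cases h : pathShift ω ∈ firstLossAt n
    · rw [Set.indicator_of_mem (this.2 h), Set.indicator_of_mem h]
    · rw [Set.indicator_of_notMem (fun h' => h (this.1 h')), Set.indicator_of_notMem h]

lemma measurable_lossEpoch (k : ℕ) : Measurable (lossEpoch k) := by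
  classical
  -- `Nat.nth` returns `0` by default when there are too few losses. Nonzero values are genuine and
  -- can be read off the path up to time `n` by counting; the value `0` is handled as the
  -- complement.
  have h0 : ∀ n, n ≠ 0 → MeasurableSet (lossEpoch k ⁻¹' {n}) := by
    intro n hn
    have : lossEpoch k ⁻¹' {n} = {ω | (ω n).2 = 0 ∧ Nat.count (fun i => (ω i).2 = 0) n = k} := by
      ext ω
      simp only [Set.mem_preimage, Set.mem_singleton_iff, Set.mem_ofPred_eq, lossEpoch]
      constructor
      · rintro rfl
        have hk : ∀ hf : (Set.ofPred (fun i => (ω i).2 = 0)).Finite, k < hf.toFinset.card := by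
          intro hf
          by_contra hk
          exact hn (Nat.nth_of_card_le hf (not_lt.1 hk))
        exact ⟨Nat.nth_mem k hk, Nat.count_nth hk⟩
      · rintro ⟨h1, rfl⟩
        exact Nat.nth_count (p := fun i => (ω i).2 = 0) h1
    rw [this]
    have e : {ω : ℕ → State | (ω n).2 = 0 ∧ Nat.count (fun i => (ω i).2 = 0) n = k} =
        Preorder.frestrictLe (π := fun _ => State) n ⁻¹' {y | (y ⟨n, Finset.mem_Iic.2 le_rfl⟩).2 = 0 ∧
          Nat.count (fun i => if h : i ≤ n then (y ⟨i, Finset.mem_Iic.2 h⟩).2 = 0 else False) n = k} := by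
      ext ω
      simp only [Set.mem_ofPred_eq, Set.mem_preimage]
      refine and_congr_right fun _ => ?_
      rw [Nat.count_eq_card_filter_range, Nat.count_eq_card_filter_range]
      have : ∀ i ∈ Finset.range n, ((ω i).2 = 0 ↔ (if h : i ≤ n then (Preorder.frestrictLe (π := fun _ => State) n ω ⟨i, Finset.mem_Iic.2 h⟩).2 = 0 else False)) := by
        intro i hi
        simp [(Finset.mem_range.1 hi).le]
      rw [Finset.filter_congr this]
    rw [e]
    exact Preorder.measurable_frestrictLe n .of_discrete
  refine measurable_to_countable' fun n => ?_
  rcases eq_or_ne n 0 with rfl | hn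
  · have : lossEpoch k ⁻¹' {0} = (⋃ n : ℕ, lossEpoch k ⁻¹' {n + 1})ᶜ := by
      ext ω
      simp only [Set.mem_preimage, Set.mem_singleton_iff, Set.mem_compl_iff, Set.mem_iUnion,
        not_exists]
      constructor
      · intro h n; omega
      · intro h
        by_contra h'
        obtain ⟨m, hm⟩ := Nat.exists_eq_succ_of_ne_zero h'
        exact h m hm
    rw [this]
    exact (MeasurableSet.iUnion fun n => h0 _ (Nat.succ_ne_zero n)).compl
  · exact h0 n hn

/-- The path from its first loss epoch on. -/
noncomputable def fromFirstLoss (ω : ℕ → State) : ℕ → State := fun n => ω (n + lossEpoch 0 ω)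

lemma measurable_fromFirstLoss : Measurable fromFirstLoss := by
  refine measurable_pi_lambda _ fun n s hs => ?_
  have : (fun ω => fromFirstLoss ω n) ⁻¹' s =
      ⋃ k, lossEpoch 0 ⁻¹' {k} ∩ (fun ω : ℕ → State => ω (n + k)) ⁻¹' s := by
    ext ω; simp [fromFirstLoss]
  rw [this]
  exact .iUnion fun k => (measurable_lossEpoch 0 (measurableSet_singleton _)).inter
    (measurable_pi_apply _ hs)

/-- The state at the first loss epoch, as a kernel in the initial state. -/
noncomputable def firstLossKernel (C β R : ℝ) (p : unitInterval) : Kernel State State :=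
  (pathKernel C β R p).map fun ω => fromFirstLoss ω 0

lemma measurable_fromFirstLoss_zero : Measurable fun ω => fromFirstLoss ω 0 :=
  (measurable_pi_apply 0).comp measurable_fromFirstLoss

instance (C β R : ℝ) (p : unitInterval) : IsMarkovKernel (firstLossKernel C β R p) :=
  Kernel.IsMarkovKernel.map _ measurable_fromFirstLoss_zero

/-- On each of these events the first loss time is the constant `n`, so both sides obey the same
first-step recursion in `n`. -/
lemma setLIntegral_firstLossAt_markov {H : (ℕ → State) → ℝ≥0∞} (hH : Measurable H) (n : ℕ)
    (x : State) :
    ∫⁻ ω in firstLossAt n, H (fun k => ω (k + n)) ∂pathKernel C β R p x =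
      ∫⁻ ω in firstLossAt n, ∫⁻ ω', H ω' ∂pathKernel C β R p (ω n) ∂pathKernel C β R p x := by
  have hmeas : Measurable fun y => ∫⁻ ω', H ω' ∂pathKernel C β R p y := .of_discrete
  induction n generalizing x with
  | zero =>
    rw [setLIntegral_firstLossAt_zero, setLIntegral_firstLossAt_zero]
    split_ifs
    · have : ∫⁻ ω, ∫⁻ ω', H ω' ∂pathKernel C β R p (ω 0) ∂pathKernel C β R p x =
          ∫⁻ _, ∫⁻ ω', H ω' ∂pathKernel C β R p x ∂pathKernel C β R p x :=
        lintegral_congr_ae (by filter_upwards [ae_pathKernel_zero x] with ω hω; rw [hω])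
      rw [this]
      simp
    · rfl
  | succ n ih =>
    have h1 := setLIntegral_firstLossAt_succ (C := C) (β := β) (R := R) (p := p) x n
      (F := fun ω => H fun k => ω (k + n)) (hH.comp (by fun_prop))
    have h2 := setLIntegral_firstLossAt_succ (C := C) (β := β) (R := R) (p := p) x n
      (F := fun ω => ∫⁻ ω', H ω' ∂pathKernel C β R p (ω n))
      (hmeas.comp (measurable_pi_apply n))
    simp_rw [ih] at h1
    exact h1.trans h2.symm

omit [IsProbabilityMeasure μ] in
/-- The strong Markov property at the first loss epoch. -/
lemma chainLaw_map_fromFirstLoss (hp0 : 0 < p) :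
    (chainLaw C β R p μ).map fromFirstLoss =
      chainLaw C β R p (firstLossKernel C β R p ∘ₘ μ) := by
  have h : ∀ x, (pathKernel C β R p).map fromFirstLoss x =
      (pathKernel C β R p ∘ₖ firstLossKernel C β R p) x := by
    intro x
    refine Measure.ext_of_lintegral _ fun H hH => ?_
    rw [Kernel.map_apply _ measurable_fromFirstLoss, lintegral_map hH measurable_fromFirstLoss,
      Kernel.lintegral_comp _ _ _ hH, firstLossKernel,
      Kernel.map_apply _ measurable_fromFirstLoss_zero,
      lintegral_map .of_discrete measurable_fromFirstLoss_zero, ← chainLaw_dirac,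
      lintegral_eq_tsum_firstLossAt hp0, lintegral_eq_tsum_firstLossAt hp0]
    refine tsum_congr fun n => ?_
    rw [chainLaw_dirac]
    refine Eq.trans ?_ ((setLIntegral_firstLossAt_markov (C := C) (β := β) (R := R) (p := p) hH n x).trans ?_)
    · refine setLIntegral_congr_fun (measurableSet_firstLossAt n) fun ω hω => ?_
      have e : fromFirstLoss ω = fun k => ω (k + n) := by
        funext k; rw [fromFirstLoss, lossEpoch_zero_of_mem hω]
      exact congrArg H e
    · refine setLIntegral_congr_fun (measurableSet_firstLossAt n) fun ω hω => ?_
      have e : fromFirstLoss ω 0 = ω n := by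
        rw [fromFirstLoss, lossEpoch_zero_of_mem hω, zero_add]
      exact congrArg (fun y => ∫⁻ ω', H ω' ∂pathKernel C β R p y) e.symm
  rw [chainLaw_eq_comp, chainLaw_eq_comp, Measure.map_comp _ _ measurable_fromFirstLoss,
    Measure.comp_assoc, Kernel.ext h]

lemma firstLossKernel_of_eq_zero {x : State} (hx : x.2 = 0) :
    firstLossKernel C β R p x = Measure.dirac x := by
  rw [firstLossKernel, Kernel.map_apply _ measurable_fromFirstLoss_zero]
  have : (fun ω => fromFirstLoss ω 0) =ᵐ[pathKernel C β R p x] fun _ => x := by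
    filter_upwards [ae_pathKernel_zero x] with ω hω
    have : ω ∈ firstLossAt 0 := by simp [firstLossAt, hω, hx]
    simp [fromFirstLoss, lossEpoch_zero_of_mem this, hω]
  rw [Measure.map_congr this, Measure.map_const]
  simp

/-- If `h` dominates `V` at loss epochs and is superharmonic elsewhere, it dominates the
expectation of `V` at the first loss epoch. -/
lemma lintegral_firstLossKernel_le (hp0 : 0 < p) (V h : State → ℝ≥0∞)
    (h0 : ∀ x : State, x.2 = 0 → V x ≤ h x)
    (h1 : ∀ x : State, x.2 ≠ 0 → ∫⁻ y, h y ∂stepKernel C β R p x ≤ h x) (x : State) :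
    ∫⁻ y, V y ∂firstLossKernel C β R p x ≤ h x := by
  have hV : ∀ n, Measurable fun ω : ℕ → State => V (ω n) := fun n =>
    (Measurable.of_discrete (f := V)).comp (measurable_pi_apply n)
  rw [firstLossKernel, Kernel.map_apply _ measurable_fromFirstLoss_zero,
    lintegral_map .of_discrete measurable_fromFirstLoss_zero, ← chainLaw_dirac,
    lintegral_eq_tsum_firstLossAt hp0, chainLaw_dirac]
  have e : ∀ n, ∫⁻ ω in firstLossAt n, V (fromFirstLoss ω 0) ∂pathKernel C β R p x =
      ∫⁻ ω in firstLossAt n, V (ω n) ∂pathKernel C β R p x := fun n =>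
    setLIntegral_congr_fun (measurableSet_firstLossAt n) fun ω hω => by
      simp only [fromFirstLoss, lossEpoch_zero_of_mem hω, zero_add]
  simp_rw [e]
  -- Only losses before time `N` are counted, so that induction on `N`, for all starting states at
  -- once, can use superharmonicity one step at a time.
  refine ENNReal.tsum_le_of_sum_range_le fun N => ?_
  clear e
  induction N generalizing x with
  | zero => simp
  | succ N ih =>
    rw [Finset.sum_range_succ']
    have e : ∀ n, ∫⁻ ω in firstLossAt (n + 1), V (ω (n + 1)) ∂pathKernel C β R p x = _ := fun n =>
      setLIntegral_firstLossAt_succ x n (hV n)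
    simp_rw [e]
    rw [setLIntegral_firstLossAt_zero]
    by_cases hx : x.2 = 0
    · simp only [hx, if_true, Finset.sum_const_zero, zero_add]
      refine le_trans (le_of_eq ?_) (h0 x hx)
      have : ∫⁻ ω, V (ω 0) ∂pathKernel C β R p x = ∫⁻ _, V x ∂pathKernel C β R p x :=
        lintegral_congr_ae (by filter_upwards [ae_pathKernel_zero x] with ω hω; rw [hω])
      rw [this]; simp
    · simp only [hx, if_false, add_zero]
      rw [← lintegral_finsetSum _ fun n _ => .of_discrete]
      exact (lintegral_mono ih).trans (h1 x hx)

end Paths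

/-! ### Convergence of countable Markov chains with tight orbits -/

section Evolution

open Filter Topology

variable {S : Type*} [MeasurableSpace S]

/-- The law at time `n` of the Markov chain with kernel `K` and initial law `μ`. -/
noncomputable def evolve (K : Kernel S S) (n : ℕ) (μ : Measure S) : Measure S :=
  (fun ν => K ∘ₘ ν)^[n] μ

lemma evolve_zero (K : Kernel S S) (μ : Measure S) : evolve K 0 μ = μ := by
  rw [evolve, Function.iterate_zero, id]

lemma evolve_succ (K : Kernel S S) (n : ℕ) (μ : Measure S) :
    evolve K (n + 1) μ = K ∘ₘ evolve K n μ :=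
  Function.iterate_succ_apply' _ _ _

lemma evolve_succ' (K : Kernel S S) (n : ℕ) (μ : Measure S) :
    evolve K (n + 1) μ = evolve K n (K ∘ₘ μ) := by
  rw [evolve, Function.iterate_succ_apply, evolve]

lemma evolve_add (K : Kernel S S) (m n : ℕ) (μ : Measure S) :
    evolve K (m + n) μ = evolve K n (evolve K m μ) := by
  rw [add_comm, evolve, Function.iterate_add_apply, evolve, evolve]

lemma evolve_add_measure (K : Kernel S S) (n : ℕ) (μ ν : Measure S) :
    evolve K n (μ + ν) = evolve K n μ + evolve K n ν := by
  induction n generalizing μ ν with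
  | zero => simp_rw [evolve_zero]
  | succ n ih => simp_rw [evolve_succ', Measure.comp_add, ih]

lemma evolve_invariant {K : Kernel S S} {π : Measure S} (h : K ∘ₘ π = π) (n : ℕ) :
    evolve K n π = π := by
  induction n with
  | zero => rw [evolve_zero]
  | succ n ih => rw [evolve_succ', h, ih]

variable {K : Kernel S S} [IsMarkovKernel K]

lemma evolve_univ (n : ℕ) (μ : Measure S) : evolve K n μ Set.univ = μ Set.univ := by
  induction n with
  | zero => rw [evolve_zero]
  | succ n ih =>
    rw [evolve_succ, Measure.bind_apply .univ (Kernel.aemeasurable _)]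
    simp [ih]

instance (n : ℕ) (μ : Measure S) [IsProbabilityMeasure μ] :
    IsProbabilityMeasure (evolve K n μ) := ⟨by rw [evolve_univ, measure_univ]⟩

instance (n : ℕ) (μ : Measure S) [IsFiniteMeasure μ] :
    IsFiniteMeasure (evolve K n μ) := ⟨by rw [evolve_univ]; exact measure_lt_top _ _⟩

variable [Countable S] [MeasurableSingletonClass S]

omit [IsMarkovKernel K] in
lemma evolve_apply (n : ℕ) (μ : Measure S) (s : Set S) :
    evolve K n μ s = ∫⁻ x, evolve K n (Measure.dirac x) s ∂μ := by
  induction n generalizing μ with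
  | zero =>
    simp_rw [evolve_zero, Measure.dirac_apply]
    rw [lintegral_indicator_one .of_discrete]
  | succ n ih =>
    have h : ∀ x, evolve K (n + 1) (Measure.dirac x) s =
        ∫⁻ y, evolve K n (Measure.dirac y) s ∂K x := fun x => by
      rw [evolve_succ', Measure.dirac_bind (Kernel.measurable _), ih]
    rw [evolve_succ', ih, lintegral_congr h,
      Measure.lintegral_bind (Kernel.aemeasurable _) Measurable.of_discrete.aemeasurable]

lemma measure_le_of_singleton {μ ν : Measure S} (h : ∀ x, μ {x} ≤ ν {x}) : μ ≤ ν := by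
  refine Measure.le_iff.2 fun s hs => ?_
  rw [← Measure.tsum_indicator_apply_singleton μ s hs,
    ← Measure.tsum_indicator_apply_singleton ν s hs]
  exact ENNReal.tsum_le_tsum fun x => Set.indicator_le_indicator (h x)

lemma exists_finset_measure_compl_le (μ : Measure S) [IsFiniteMeasure μ] {δ : ℝ≥0∞}
    (hδ : δ ≠ 0) : ∃ F : Finset S, μ (F : Set S)ᶜ ≤ δ := by
  have hsum : ∑' x, μ {x} ≠ ∞ := by
    have := Measure.tsum_indicator_apply_singleton μ Set.univ .univ
    simp only [Set.indicator_univ] at this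
    rw [this]; exact measure_ne_top _ _
  have h := ENNReal.tendsto_tsum_compl_atTop_zero hsum
  obtain ⟨F, hF⟩ := (h.eventually (Iic_mem_nhds (pos_iff_ne_zero.2 hδ))).exists
  refine ⟨F, ?_⟩
  rw [← Measure.tsum_indicator_apply_singleton μ _ .of_discrete, ← tsum_subtype]
  exact hF

/-- The laws of the chain with initial law `μ` are tight. -/
def TightOrbit (K : Kernel S S) (μ : Measure S) : Prop :=
  ∀ δ : ℝ≥0∞, δ ≠ 0 → ∃ F : Finset S, ∀ n, evolve K n μ (F : Set S)ᶜ ≤ δ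

/-- A finite set carries all but `δ / 2` of `μ`; the union of the finite sets that serve its points
works for `μ`. -/
lemma tightOrbit_of_dirac (h : ∀ x, TightOrbit K (Measure.dirac x)) (μ : Measure S)
    [IsProbabilityMeasure μ] : TightOrbit K μ := by
  classical
  intro δ hδ
  have hδ2 : δ / 2 ≠ 0 := by simpa using hδ
  obtain ⟨F₀, hF₀⟩ := exists_finset_measure_compl_le μ hδ2
  choose G hG using fun x => h x (δ / 2) hδ2
  refine ⟨F₀.biUnion G, fun n => ?_⟩
  rw [evolve_apply, ← lintegral_add_compl _ (MeasurableSet.of_discrete (s := (F₀ : Set S))),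
    ← ENNReal.add_halves δ]
  gcongr
  · calc _ ≤ ∫⁻ x in (F₀ : Set S), δ / 2 ∂μ := by
          refine setLIntegral_mono measurable_const fun x hx => ?_
          refine (measure_mono ?_).trans (hG x n)
          rw [Set.compl_subset_compl]
          exact_mod_cast Finset.subset_biUnion_of_mem G hx
      _ ≤ δ / 2 := by
        rw [setLIntegral_const]
        exact mul_le_of_le_one_right zero_le prob_le_one
  · calc _ ≤ ∫⁻ x in (F₀ : Set S)ᶜ, 1 ∂μ := lintegral_mono fun x => prob_le_one
      _ ≤ δ / 2 := by rw [setLIntegral_const, one_mul]; exact hF₀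

lemma tightOrbit_of_drift {V : S → ℝ≥0∞} {l b : ℝ≥0∞} (hl : l < 1) (hb : b ≠ ∞)
    (hV : ∀ x, V x ≠ ∞) (hdrift : ∀ x, ∫⁻ y, V y ∂K x ≤ l * V x + b)
    (hfin : ∀ c, c ≠ ∞ → {x | V x ≤ c}.Finite) (x : S) : TightOrbit K (Measure.dirac x) := by
  -- The fixed point of `t ↦ l * t + b`. It bounds the accumulated drift, so the expectation of `V`
  -- stays below `V x + c`, and Markov's inequality gives tightness.
  set c := b / (1 - l) with hc
  have hl0 : 1 - l ≠ 0 := (tsub_pos_of_lt hl).ne'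
  have hlt : 1 - l ≠ ∞ := ENNReal.sub_ne_top ENNReal.one_ne_top
  have hcc : l * c + b = c := by
    have : b = (1 - l) * c := (ENNReal.mul_div_cancel hl0 hlt).symm
    rw [this, ← add_mul, add_tsub_cancel_of_le hl.le, one_mul]
  have hct : c ≠ ∞ := ENNReal.div_ne_top hb hl0
  have key : ∀ n, ∫⁻ y, V y ∂evolve K n (Measure.dirac x) ≤ V x + c := by
    intro n
    induction n with
    | zero => rw [evolve_zero, lintegral_dirac]; exact le_self_add
    | succ n ih =>
      rw [evolve_succ, Measure.lintegral_bind (Kernel.aemeasurable _)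
        Measurable.of_discrete.aemeasurable]
      calc _ ≤ ∫⁻ y, (l * V y + b) ∂evolve K n (Measure.dirac x) := lintegral_mono hdrift
        _ = l * ∫⁻ y, V y ∂evolve K n (Measure.dirac x) + b := by
          rw [lintegral_add_right _ measurable_const, lintegral_const_mul _ .of_discrete]
          simp
        _ ≤ l * (V x + c) + b := by gcongr
        _ = l * V x + c := by rw [mul_add, add_assoc, hcc]
        _ ≤ V x + c := by gcongr; exact mul_le_of_le_one_left zero_le hl.le
  intro δ hδ
  rcases eq_or_ne δ ∞ with rfl | hδt
  · exact ⟨∅, fun n => le_top⟩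
  have hBt : V x + c ≠ ∞ := ENNReal.add_ne_top.2 ⟨hV x, hct⟩
  set t := (V x + c + 1) / δ
  have ht : t ≠ ∞ := ENNReal.div_ne_top (ENNReal.add_ne_top.2 ⟨hBt, ENNReal.one_ne_top⟩) hδ
  have ht0 : t ≠ 0 := by simp [t, hδt]
  refine ⟨(hfin t ht).toFinset, fun n => ?_⟩
  refine (measure_mono (t := {y | t ≤ V y}) ?_).trans
    ((meas_ge_le_lintegral_div Measurable.of_discrete.aemeasurable ht0 ht).trans ?_)
  · intro y hy
    simp only [Set.Finite.coe_toFinset, Set.mem_compl_iff, Set.mem_ofPred_eq, not_le] at hy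
    exact hy.le
  · refine ENNReal.div_le_of_le_mul ((key n).trans ?_)
    rw [ENNReal.mul_div_cancel hδ hδt]
    exact le_self_add

omit [IsMarkovKernel K] [Countable S] in
-- The self-loop at `a` makes positivity persist in time, so the largest of finitely many hitting
-- times serves all points of `F`.
lemma exists_uniform_lower_bound {a : S} (hloop : K a {a} ≠ 0)
    (hacc : ∀ x, ∃ n, evolve K n (Measure.dirac x) {a} ≠ 0) (F : Finset S) :
    ∃ N, ∃ ε : ℝ≥0∞, ε ≠ 0 ∧ ε ≠ ∞ ∧ ∀ x ∈ F, ε ≤ evolve K N (Measure.dirac x) {a} := by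
  have hmono : ∀ x m n, m ≤ n → evolve K m (Measure.dirac x) {a} ≠ 0 →
      evolve K n (Measure.dirac x) {a} ≠ 0 := by
    intro x m n hmn h
    induction n, hmn using Nat.le_induction with
    | base => exact h
    | succ n _ ih =>
      rw [evolve_succ, Measure.bind_apply (measurableSet_singleton _) (Kernel.aemeasurable _)]
      refine ne_of_gt (lt_of_lt_of_le (pos_iff_ne_zero.2 (mul_ne_zero hloop ih)) ?_)
      calc _ = ∫⁻ y in {a}, K y {a} ∂evolve K n (Measure.dirac x) := by
            rw [lintegral_singleton]
        _ ≤ _ := setLIntegral_le_lintegral _ _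
  choose n hn using hacc
  -- The minimum with `1` keeps the bound finite when `F` is empty.
  refine ⟨F.sup n, min 1 (F.inf fun x => evolve K (F.sup n) (Measure.dirac x) {a}), ?_, ?_, ?_⟩
  · refine (lt_min one_pos ?_).ne'
    rw [Finset.lt_inf_iff (by simp)]
    exact fun x hx => pos_iff_ne_zero.2 (hmono x _ _ (Finset.le_sup hx) (hn x))
  · exact ((min_le_left _ _).trans_lt ENNReal.one_lt_top).ne
  · exact fun x hx => (min_le_right _ _).trans (Finset.inf_le hx)

/-- The coupling step. If `m` misses mass at least `δ`, each remainder has mass at least `δ / 2` on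
the finite set given by tightness. After `N` steps each remainder puts at least `ε * (δ / 2)` on
`a`, and this is added to the evolved `m`. The gain does not depend on `n` or `m`. -/
lemma exists_larger_common_part {a : S} (hloop : K a {a} ≠ 0)
    (hacc : ∀ x, ∃ n, evolve K n (Measure.dirac x) {a} ≠ 0) {μ ν : Measure S}
    [IsProbabilityMeasure μ] [IsProbabilityMeasure ν] (hμ : TightOrbit K μ)
    (hν : TightOrbit K ν) {δ : ℝ≥0∞} (hδ : δ ≠ 0) (hδt : δ ≠ ∞) :
    ∃ N, ∃ ε : ℝ≥0∞, ε ≠ 0 ∧ ∀ n (m : Measure S), m ≤ evolve K n μ → m ≤ evolve K n ν →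
      m Set.univ + δ ≤ 1 → ∃ m', m' ≤ evolve K (n + N) μ ∧ m' ≤ evolve K (n + N) ν ∧
        m Set.univ + ε ≤ m' Set.univ := by
  classical
  have hδ2 : δ / 2 ≠ 0 := by simpa using hδ
  obtain ⟨F₁, hF₁⟩ := hμ _ hδ2
  obtain ⟨F₂, hF₂⟩ := hν _ hδ2
  obtain ⟨N, ε, hε, hεt, hN⟩ := exists_uniform_lower_bound hloop hacc (F₁ ∪ F₂)
  have aux : ∀ (ρ m : Measure S) [IsProbabilityMeasure ρ],
      ρ ((F₁ ∪ F₂ : Finset S) : Set S)ᶜ ≤ δ / 2 → m ≤ ρ → m Set.univ + δ ≤ 1 →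
      evolve K N m + (ε * (δ / 2)) • Measure.dirac a ≤ evolve K N ρ := by
    intro ρ m _ hρ hm hmδ
    have : IsFiniteMeasure m := isFiniteMeasure_of_le ρ hm
    have hsub := Measure.sub_add_cancel_of_le hm
    set r := ρ - m
    have hr1 : δ ≤ r Set.univ := by
      have h1 : r Set.univ + m Set.univ = 1 := by
        rw [← Measure.add_apply, hsub, measure_univ]
      rw [← h1, add_comm] at hmδ
      exact (ENNReal.add_le_add_iff_right (measure_ne_top m _)).1 hmδ
    have hr2 : r ((F₁ ∪ F₂ : Finset S) : Set S)ᶜ ≤ δ / 2 := (Measure.sub_le _).trans hρ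
    have hr3 : δ / 2 ≤ r ((F₁ ∪ F₂ : Finset S) : Set S) := by
      have h1 := measure_add_measure_compl (μ := r)
        (MeasurableSet.of_discrete (s := ((F₁ ∪ F₂ : Finset S) : Set S)))
      have h2 : δ / 2 + δ / 2 ≤ r ((F₁ ∪ F₂ : Finset S) : Set S) + δ / 2 := by
        rw [ENNReal.add_halves]
        exact hr1.trans (h1 ▸ by gcongr)
      exact (ENNReal.add_le_add_iff_right (ENNReal.div_ne_top hδt two_ne_zero)).1 h2
    have hr4 : ε * (δ / 2) ≤ evolve K N r {a} := by
      rw [evolve_apply]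
      calc _ ≤ ∫⁻ x in ((F₁ ∪ F₂ : Finset S) : Set S), ε ∂r := by
            rw [setLIntegral_const]; gcongr
        _ ≤ ∫⁻ x in ((F₁ ∪ F₂ : Finset S) : Set S), evolve K N (Measure.dirac x) {a} ∂r :=
          setLIntegral_mono .of_discrete fun x hx => hN x hx
        _ ≤ _ := setLIntegral_le_lintegral _ _
    rw [← hsub, evolve_add_measure, add_comm]
    gcongr
    refine measure_le_of_singleton fun x => ?_
    rcases eq_or_ne a x with rfl | hax
    · simpa using hr4
    · simp [hax]
  refine ⟨N, ε * (δ / 2), mul_ne_zero hε hδ2, fun n m h1 h2 h3 =>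
    ⟨evolve K N m + (ε * (δ / 2)) • Measure.dirac a, ?_, ?_, ?_⟩⟩
  · rw [evolve_add]
    refine aux _ _ ((measure_mono ?_).trans (hF₁ n)) h1 h3
    simp
  · rw [evolve_add]
    refine aux _ _ ((measure_mono ?_).trans (hF₂ n)) h2 h3
    simp
  · simp [evolve_univ]

/-- Otherwise the fixed gain could be repeated until the common part had mass above one. -/
lemma exists_common_part {a : S} (hloop : K a {a} ≠ 0)
    (hacc : ∀ x, ∃ n, evolve K n (Measure.dirac x) {a} ≠ 0) {μ ν : Measure S}
    [IsProbabilityMeasure μ] [IsProbabilityMeasure ν] (hμ : TightOrbit K μ)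
    (hν : TightOrbit K ν) {δ : ℝ≥0∞} (hδ : δ ≠ 0) (hδt : δ ≠ ∞) :
    ∃ n, ∃ m : Measure S, m ≤ evolve K n μ ∧ m ≤ evolve K n ν ∧ 1 ≤ m Set.univ + δ := by
  by_contra! hcon
  obtain ⟨N, ε, hε, h⟩ := exists_larger_common_part hloop hacc hμ hν hδ hδt
  have key : ∀ k : ℕ, ∃ n, ∃ m : Measure S, m ≤ evolve K n μ ∧ m ≤ evolve K n ν ∧
      k * ε ≤ m Set.univ := by
    intro k
    induction k with
    | zero => exact ⟨0, 0, Measure.zero_le _, Measure.zero_le _, by simp⟩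
    | succ k ih =>
      obtain ⟨n, m, h1, h2, h3⟩ := ih
      obtain ⟨m', h1', h2', h3'⟩ := h n m h1 h2 (hcon n m h1 h2).le
      refine ⟨n + N, m', h1', h2', le_trans ?_ h3'⟩
      push_cast
      rw [add_mul, one_mul]
      gcongr
  obtain ⟨k, hk⟩ := ENNReal.exists_nat_mul_gt hε ENNReal.one_ne_top
  obtain ⟨n, m, h1, _, h3⟩ := key k
  have : m Set.univ ≤ 1 := (h1 _).trans prob_le_one
  exact absurd (hk.trans_le (h3.trans this)) (lt_irrefl _)

lemma eventually_evolve_le {a : S} (hloop : K a {a} ≠ 0)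
    (hacc : ∀ x, ∃ n, evolve K n (Measure.dirac x) {a} ≠ 0) {μ ν : Measure S}
    [IsProbabilityMeasure μ] [IsProbabilityMeasure ν] (hμ : TightOrbit K μ)
    (hν : TightOrbit K ν) {δ : ℝ≥0∞} (hδ : δ ≠ 0) :
    ∀ᶠ n in atTop, ∃ r : Measure S, r Set.univ ≤ δ ∧ evolve K n μ ≤ evolve K n ν + r := by
  have hδ1 : min δ 1 ≠ 0 := (lt_min (pos_iff_ne_zero.2 hδ) one_pos).ne'
  have hδ2 : min δ 1 ≠ ∞ := ((min_le_right _ _).trans_lt ENNReal.one_lt_top).ne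
  obtain ⟨n, m, h1, h2, h3⟩ := exists_common_part hloop hacc hμ hν hδ1 hδ2
  have : IsFiniteMeasure m := isFiniteMeasure_of_le _ h1
  have hsub := Measure.sub_add_cancel_of_le h1
  have hsub2 := Measure.sub_add_cancel_of_le h2
  set r := evolve K n μ - m
  set r' := evolve K n ν - m
  refine eventually_atTop.2 ⟨n, fun k hk => ?_⟩
  obtain ⟨j, rfl⟩ := Nat.exists_eq_add_of_le hk
  -- The common part evolves identically in both chains, and the unmatched remainder keeps its mass,
  -- so the bound persists at all later times.
  refine ⟨evolve K j r, ?_, ?_⟩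
  · rw [evolve_univ]
    have h4 : r Set.univ + m Set.univ = 1 := by rw [← Measure.add_apply, hsub, measure_univ]
    rw [← h4, add_comm] at h3
    exact ((ENNReal.add_le_add_iff_left (measure_ne_top m _)).1 h3).trans (min_le_left _ _)
  · rw [evolve_add, evolve_add, ← hsub, ← hsub2, evolve_add_measure, evolve_add_measure,
      add_comm (evolve K j r)]
    gcongr
    exact Measure.le_add_left le_rfl

/-- A chain on a countable space with tight orbits and an accessible aperiodic state has an
invariant probability measure. -/
lemma exists_invariant {a : S} (hloop : K a {a} ≠ 0)
    (hacc : ∀ x, ∃ n, evolve K n (Measure.dirac x) {a} ≠ 0)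
    (htight : ∀ x, TightOrbit K (Measure.dirac x)) :
    ∃ π : Measure S, IsProbabilityMeasure π ∧ K ∘ₘ π = π := by
  classical
  -- Limits along an ultrafilter replace the extraction of a subsequence: every atom mass converges,
  -- and tightness prevents loss of mass in the limit.
  let U : Filter ℕ := (hyperfilter ℕ : Filter ℕ)
  have hU : U ≤ atTop := Nat.hyperfilter_le_atTop
  let μ : ℕ → Measure S := fun n => evolve K n (Measure.dirac a)
  have hex : ∀ x, ∃ l : ℝ≥0∞, Tendsto (fun n => μ n {x}) U (𝓝 l) := by
    intro x
    obtain ⟨l, -, hl⟩ := isCompact_univ.ultrafilter_le_nhds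
      ((hyperfilter ℕ).map fun n => μ n {x}) (by simp)
    exact ⟨l, hl⟩
  choose l hl using hex
  let π : Measure S := Measure.sum fun x => l x • Measure.dirac x
  have hπ : ∀ x, π {x} = l x := by
    intro x
    simp only [π]
    rw [Measure.sum_apply _ (measurableSet_singleton _), tsum_eq_single x]
    · simp
    · intro y hy; simp [hy]
  have hπF : ∀ F : Finset S, Tendsto (fun n => μ n (F : Set S)) U (𝓝 (π F)) := by
    intro F
    simp_rw [← sum_measure_singleton, hπ]
    exact tendsto_finsetSum _ fun x _ => hl x
  have hle : π Set.univ ≤ 1 := by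
    rw [← Measure.tsum_indicator_apply_singleton π _ .univ, ENNReal.tsum_eq_iSup_sum]
    refine iSup_le fun F => ?_
    simp only [Set.indicator_univ]
    rw [sum_measure_singleton]
    exact le_of_tendsto' (hπF F) fun n => prob_le_one
  have hge : 1 ≤ π Set.univ := by
    refine ENNReal.le_of_forall_pos_le_add fun δ hδ _ => ?_
    obtain ⟨F, hF⟩ := htight a δ (by exact_mod_cast hδ.ne')
    have h1 : ∀ n, 1 ≤ μ n (F : Set S) + δ := by
      intro n
      rw [← measure_univ (μ := μ n),
        ← measure_add_measure_compl (MeasurableSet.of_discrete (s := (F : Set S)))]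
      gcongr
      exact hF n
    refine (ge_of_tendsto' ((hπF F).add_const _) h1).trans ?_
    gcongr
    exact Set.subset_univ _
  have : IsProbabilityMeasure π := ⟨le_antisymm hle hge⟩
  -- Both measures have mass one, so one inequality on atoms is enough.
  refine ⟨π, this, Measure.eq_of_le_of_isProbabilityMeasure (measure_le_of_singleton fun y => ?_)⟩
  refine ENNReal.le_of_forall_pos_le_add fun δ hδ _ => ?_
  rw [Measure.bind_apply (measurableSet_singleton _) (Kernel.aemeasurable _), lintegral_countable',
    ENNReal.tsum_eq_iSup_sum]
  refine iSup_le fun F => ?_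
  have h1 : Tendsto (fun n => ∑ x ∈ F, K x {y} * μ n {x}) U (𝓝 (∑ x ∈ F, K x {y} * π {x})) := by
    refine tendsto_finsetSum _ fun x _ => ?_
    rw [hπ]
    exact ENNReal.Tendsto.const_mul (hl x) (Or.inr (measure_ne_top _ _))
  have h2 : Tendsto (fun n => μ n {y} + δ) U (𝓝 (π {y} + δ)) := by
    rw [hπ]; exact (hl y).add_const _
  refine le_of_tendsto_of_tendsto h1 h2 ?_
  -- Coupling the chain from `a` with itself one step ahead shows that consecutive laws merge, which
  -- makes the limit invariant.
  have h3 := eventually_evolve_le hloop hacc (μ := K ∘ₘ Measure.dirac a) (ν := Measure.dirac a)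
    (tightOrbit_of_dirac htight _) (htight a) (δ := δ) (by exact_mod_cast hδ.ne')
  filter_upwards [hU h3] with n ⟨r, hr, hn⟩
  calc ∑ x ∈ F, K x {y} * μ n {x} ≤ ∑' x, K x {y} * μ n {x} := ENNReal.sum_le_tsum F
    _ = evolve K (n + 1) (Measure.dirac a) {y} := by
      rw [evolve_succ, Measure.bind_apply (measurableSet_singleton _) (Kernel.aemeasurable _),
        lintegral_countable']
    _ ≤ (μ n + r) {y} := by rw [evolve_succ']; exact hn _
    _ ≤ μ n {y} + δ := by
      rw [Measure.add_apply]; gcongr; exact (measure_mono (Set.subset_univ _)).trans hr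

/-- `π` is an invariant probability measure to which the law of the chain converges in total
variation, whatever the initial law. -/
structure IsAttracting (K : Kernel S S) (π : Measure S) : Prop where
  isProbabilityMeasure : IsProbabilityMeasure π
  invariant : K ∘ₘ π = π
  exists_evolve_le : ∀ μ : Measure S, IsProbabilityMeasure μ → ∀ δ : ℝ≥0∞, δ ≠ 0 →
    ∃ n, ∃ r : Measure S, r Set.univ ≤ δ ∧ evolve K n μ ≤ π + r

theorem exists_isAttracting {a : S} (hloop : K a {a} ≠ 0)
    (hacc : ∀ x, ∃ n, evolve K n (Measure.dirac x) {a} ≠ 0)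
    (htight : ∀ x, TightOrbit K (Measure.dirac x)) : ∃ π : Measure S, IsAttracting K π := by
  obtain ⟨π, h1, h2⟩ := exists_invariant hloop hacc htight
  refine ⟨π, h1, h2, fun μ _ δ hδ => ?_⟩
  obtain ⟨n, r, hr, h⟩ := (eventually_evolve_le hloop hacc (tightOrbit_of_dirac htight μ)
    (tightOrbit_of_dirac htight π) hδ).exists
  exact ⟨n, r, hr, by rwa [evolve_invariant h2] at h⟩

end Evolution

/-! ### Geometric drift for the CUBIC window -/

lemma windowSize_le {C β R : ℝ} (hC : 0 < C) (hβ0 : 0 < β) (hR : 0 < R) (s : State) :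
    ((windowSize C β R s : ℕ) : ℝ) ≤ 1 + (s.1 : ℕ) + C * R ^ 3 * (s.2 : ℝ) ^ 3 := by
  have hk : 0 ≤ (β * ((s.1 : ℕ) : ℝ) / C) ^ (1 / 3 : ℝ) := by positivity
  have h1 : cubicCurve C β (s.1 : ℕ) (R * s.2) ≤ (s.1 : ℕ) + C * R ^ 3 * (s.2 : ℝ) ^ 3 := by
    have h : (R * s.2 - (β * ((s.1 : ℕ) : ℝ) / C) ^ (1 / 3 : ℝ)) ^ 3 ≤ (R * s.2) ^ 3 :=
      (Odd.strictMono_pow (by decide)).monotone (by linarith)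
    have := mul_le_mul_of_nonneg_left h hC.le
    rw [cubicCurve]
    linarith [mul_pow R (s.2 : ℝ) 3, this, mul_assoc C (R ^ 3) ((s.2 : ℝ) ^ 3),
      congrArg (C * ·) (mul_pow R (s.2 : ℝ) 3)]
  have h2 : (0 : ℝ) ≤ (s.1 : ℕ) + C * R ^ 3 * (s.2 : ℝ) ^ 3 := by positivity
  have h3 : ((⌊cubicCurve C β (s.1 : ℕ) (R * s.2)⌋₊ : ℕ) : ℝ) ≤
      (s.1 : ℕ) + C * R ^ 3 * (s.2 : ℝ) ^ 3 :=
    (Nat.cast_le.2 (Nat.floor_mono h1)).trans (Nat.floor_le h2)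
  simp only [windowSize, Nat.cast_max, Nat.cast_one]
  exact max_le (by linarith) (by linarith)

lemma windowSize_loss {C β R : ℝ} (hC : 0 < C) (hβ0 : 0 < β) (z : Window) :
    (windowSize C β R (z, 0) : ℕ) = max 1 ⌊(1 - β) * ((z : ℕ) : ℝ)⌋₊ := by
  have h : ((β * ((z : ℕ) : ℝ) / C) ^ (1 / 3 : ℝ)) ^ 3 = β * ((z : ℕ) : ℝ) / C := by
    rw [← Real.rpow_natCast, ← Real.rpow_mul (by positivity)]
    norm_num
  have h2 : cubicCurve C β (z : ℕ) (R * ((0 : ℕ) : ℝ)) = (1 - β) * ((z : ℕ) : ℝ) := by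
    have h3 : cubicCurve C β (z : ℕ) (R * ((0 : ℕ) : ℝ)) =
        -(C * ((β * ((z : ℕ) : ℝ) / C) ^ (1 / 3 : ℝ)) ^ 3) + (z : ℕ) := by
      rw [cubicCurve]; push_cast; ring
    rw [h3, h]
    field_simp
    ring
  simp only [windowSize]
  rw [h2]

/-- A Lyapunov function for the chain. -/
noncomputable def lyapunov (q : ℝ) (s : State) : ℝ :=
  if s.2 = 0 then (s.1 : ℕ) else 2 / (1 - q) * (s.1 : ℕ) + ((1 + q) / (2 * q)) ^ s.2

section

variable {q : ℝ} (hq0 : 0 < q) (hq1 : q < 1)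

include hq0 hq1

lemma one_lt_lyapunov_base : 1 < (1 + q) / (2 * q) := by
  rw [lt_div_iff₀ (by positivity)]; linarith

lemma le_lyapunov (s : State) : ((s.1 : ℕ) : ℝ) ≤ lyapunov q s := by
  rw [lyapunov]
  split_ifs
  · exact le_rfl
  · have h1 : 1 ≤ 2 / (1 - q) := by rw [le_div_iff₀ (by linarith)]; linarith
    have h2 : (0 : ℝ) ≤ ((1 + q) / (2 * q)) ^ s.2 := by positivity
    nlinarith [Nat.cast_nonneg (α := ℝ) (s.1 : ℕ)]

omit hq0 in
lemma pow_le_lyapunov (s : State) : ((1 + q) / (2 * q)) ^ s.2 ≤ lyapunov q s := by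
  rw [lyapunov]
  split_ifs with h
  · rw [h, pow_zero]; exact_mod_cast s.1.2
  · have : 0 ≤ 2 / (1 - q) * ((s.1 : ℕ) : ℝ) := by
      have : 0 < 1 - q := by linarith
      positivity
    linarith

lemma lyapunov_sublevel_finite (c : ℝ) : {s | lyapunov q s ≤ c}.Finite := by
  have hr := one_lt_lyapunov_base hq0 hq1
  obtain ⟨N, hN⟩ := exists_nat_ge c
  obtain ⟨D, hD⟩ := exists_nat_ge (c / ((1 + q) / (2 * q) - 1))
  have hfin : ((fun s : State => ((s.1 : ℕ), s.2)) ⁻¹'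
      (Finset.Iic N ×ˢ Finset.Iic D : Finset (ℕ × ℕ))).Finite := by
    refine Set.Finite.preimage (fun s _ t _ h => ?_) (Finset.finite_toSet _)
    simp only [Prod.mk.injEq] at h
    exact Prod.ext (Subtype.ext h.1) h.2
  refine hfin.subset ?_
  intro s hs
  simp only [Set.mem_ofPred_eq] at hs
  simp only [Set.mem_preimage, Finset.mem_coe, Finset.mem_product, Finset.mem_Iic]
  constructor
  · exact_mod_cast (le_lyapunov hq0 hq1 s).trans (hs.trans hN)
  · have h1 := one_add_mul_le_pow (a := (1 + q) / (2 * q) - 1) (by linarith) s.2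
    rw [add_sub_cancel] at h1
    have h2 := pow_le_lyapunov hq1 s
    have h3 : (s.2 : ℝ) ≤ c / ((1 + q) / (2 * q) - 1) := by
      rw [le_div_iff₀ (by linarith)]; linarith
    exact_mod_cast h3.trans hD

lemma exists_cube_le_pow (c : ℝ) (hc : 0 ≤ c) :
    ∃ b, 0 ≤ b ∧ ∀ d : ℕ, c * (d : ℝ) ^ 3 ≤ (1 - q) / 4 * ((1 + q) / (2 * q)) ^ d + b := by
  have hr := one_lt_lyapunov_base hq0 hq1
  have h := (tendsto_pow_const_div_const_pow_of_one_lt 3 hr).const_mul c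
  rw [mul_zero] at h
  have hpos : 0 < (1 - q) / 4 := by linarith
  obtain ⟨N, hN⟩ := Filter.eventually_atTop.1 (h.eventually (Iio_mem_nhds hpos))
  refine ⟨c * (N : ℝ) ^ 3, by positivity, fun d => ?_⟩
  have hrd : 0 < ((1 + q) / (2 * q)) ^ d := by positivity
  rcases le_total N d with hd | hd
  · have h1 : c * ((d : ℝ) ^ 3 / ((1 + q) / (2 * q)) ^ d) < (1 - q) / 4 := hN d hd
    rw [← mul_div_assoc, div_lt_iff₀ hrd] at h1
    have : 0 ≤ c * (N : ℝ) ^ 3 := by positivity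
    linarith
  · have h1 : (d : ℝ) ^ 3 ≤ (N : ℝ) ^ 3 := by gcongr
    have h2 := mul_le_mul_of_nonneg_left h1 hc
    have h3 := mul_pos hpos hrd
    linarith

lemma exists_bound_pow_mul (A B : ℝ) (hA : 0 ≤ A) (hB : 0 ≤ B) :
    ∃ b, 0 ≤ b ∧ ∀ n : ℕ, q ^ n * (A * n + B) ≤ b := by
  obtain ⟨c, hc⟩ := (tendsto_self_mul_const_pow_of_lt_one hq0.le hq1).bddAbove_range
  have hc' : ∀ n : ℕ, (n : ℝ) * q ^ n ≤ c := fun n => hc ⟨n, rfl⟩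
  have hc0 : 0 ≤ c := by simpa using hc' 0
  refine ⟨A * c + B, by positivity, fun n => ?_⟩
  have h1 := mul_le_mul_of_nonneg_left (hc' n) hA
  have h2 := mul_le_mul_of_nonneg_left (pow_le_one₀ (n := n) hq0.le hq1.le) hB
  linarith

/-- Write `z` for the window at the last loss, `d` for the elapsed time, `w` for the current window,
`r = (1 + q) / (2 * q)` and `M = 2 / (1 - q)`. At `d = 0` a loss contracts `z` by `1 - β` up to a
constant; no loss has probability `q ^ w` with `z ≤ (w + 1) / (1 - β)`, so its contribution is
bounded. At `d > 0` the choices give `q * r = (1 + q) / 2 < 1` and `q * M + 1 = (1 + q) / 2 * M`,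
which absorbs the `z` in the bound on `w` after a loss. The cubic growth of `w` costs at most `(1 -
q) / 4 * r ^ d` plus a constant, and `(1 + q) / 2 + (1 - q) / 4 = (3 + q) / 4`. -/
lemma lyapunov_drift {C β R : ℝ} (hC : 0 < C) (hβ0 : 0 < β) (hβ1 : β < 1) (hR : 0 < R) :
    ∃ l b : ℝ, 0 ≤ l ∧ l < 1 ∧ 0 ≤ b ∧ ∀ s : State,
      q ^ (windowSize C β R s : ℕ) * lyapunov q (s.1, s.2 + 1) +
        (1 - q ^ (windowSize C β R s : ℕ)) * lyapunov q (windowSize C β R s, 0) ≤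
      l * lyapunov q s + b := by
  have hq1' : 0 < 1 - q := by linarith
  have hβ1' : 0 < 1 - β := by linarith
  obtain ⟨b₁, hb₁, h₁⟩ := exists_cube_le_pow hq0 hq1 (C * R ^ 3) (by positivity)
  obtain ⟨b₂, hb₂, h₂⟩ := exists_bound_pow_mul hq0 hq1 (2 / (1 - q) / (1 - β))
    (2 / (1 - q) / (1 - β) + (1 + q) / (2 * q)) (by positivity) (by positivity)
  refine ⟨max (1 - β) ((3 + q) / 4), b₁ + b₂ + 1, by positivity,
    max_lt (by linarith) (by linarith), by positivity, fun s => ?_⟩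
  have hw1 : (1 : ℝ) ≤ (windowSize C β R s : ℕ) := by exact_mod_cast (windowSize C β R s).2
  have hqw : 0 < q ^ (windowSize C β R s : ℕ) := by positivity
  have hqq : q ^ (windowSize C β R s : ℕ) ≤ q :=
    pow_le_of_le_one hq0.le hq1.le (Nat.one_le_iff_ne_zero.1 (windowSize C β R s).2)
  have hup := windowSize_le hC hβ0 hR s
  have hloss : lyapunov q (windowSize C β R s, 0) = (windowSize C β R s : ℕ) := by
    simp [lyapunov]
  have hnext : lyapunov q (s.1, s.2 + 1) =
      2 / (1 - q) * (s.1 : ℕ) + ((1 + q) / (2 * q)) ^ (s.2 + 1) := by simp [lyapunov]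
  have hlyap : 0 ≤ lyapunov q s := (Nat.cast_nonneg _).trans (le_lyapunov hq0 hq1 s)
  rw [hloss, hnext]
  rcases eq_or_ne s.2 0 with hs | hs
  · have hm := mul_le_mul_of_nonneg_right (le_max_left (1 - β) ((3 + q) / 4)) hlyap
    have hs' : s = (s.1, 0) := Prod.ext rfl hs
    have hw : (windowSize C β R s : ℕ) = max 1 ⌊(1 - β) * ((s.1 : ℕ) : ℝ)⌋₊ := by
      rw [hs']; exact windowSize_loss hC hβ0 s.1
    have hz0 : 0 ≤ (1 - β) * ((s.1 : ℕ) : ℝ) := by positivity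
    have hle : ((windowSize C β R s : ℕ) : ℝ) ≤ 1 + (1 - β) * ((s.1 : ℕ) : ℝ) := by
      rw [hw, Nat.cast_max, Nat.cast_one]
      exact max_le (by linarith) (by linarith [Nat.floor_le hz0])
    have hge : (1 - β) * ((s.1 : ℕ) : ℝ) ≤ (windowSize C β R s : ℕ) + 1 := by
      have h1 := (Nat.lt_floor_add_one ((1 - β) * ((s.1 : ℕ) : ℝ))).le
      have h2 : ((⌊(1 - β) * ((s.1 : ℕ) : ℝ)⌋₊ : ℕ) : ℝ) ≤ (windowSize C β R s : ℕ) := by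
        rw [hw]; exact_mod_cast le_max_right _ _
      linarith
    have hz : ((s.1 : ℕ) : ℝ) ≤ ((windowSize C β R s : ℕ) + 1) / (1 - β) := by
      rw [le_div_iff₀ hβ1']; linarith
    have hl : lyapunov q s = (s.1 : ℕ) := by simp [lyapunov, hs]
    rw [hl] at hm ⊢
    rw [hs, zero_add, pow_one]
    have h3 := h₂ (windowSize C β R s : ℕ)
    have h4 : q ^ (windowSize C β R s : ℕ) * (2 / (1 - q) * (s.1 : ℕ) + (1 + q) / (2 * q)) ≤ b₂ := by
      refine le_trans (mul_le_mul_of_nonneg_left ?_ hqw.le) h3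
      have h5 := mul_le_mul_of_nonneg_left hz (show 0 ≤ 2 / (1 - q) by positivity)
      have h6 : 2 / (1 - q) * (((windowSize C β R s : ℕ) + 1) / (1 - β)) =
          2 / (1 - q) / (1 - β) * (windowSize C β R s : ℕ) + 2 / (1 - q) / (1 - β) := by ring
      linarith
    nlinarith
  · have hm := mul_le_mul_of_nonneg_right (le_max_right (1 - β) ((3 + q) / 4)) hlyap
    have hl : lyapunov q s = 2 / (1 - q) * (s.1 : ℕ) + ((1 + q) / (2 * q)) ^ s.2 := by
      simp [lyapunov, hs]
    have h3 := h₁ s.2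
    set Z : ℝ := ((s.1 : ℕ) : ℝ)
    set D : ℝ := ((1 + q) / (2 * q)) ^ s.2 with hDdef
    have hZ : 0 ≤ Z := Nat.cast_nonneg _
    have hD : 0 < D := by positivity
    have hD' : q * ((1 + q) / (2 * q)) ^ (s.2 + 1) = (1 + q) / 2 * D := by
      rw [pow_succ, ← hDdef]; field_simp
    have hM : q * (2 / (1 - q) * Z) + Z = (1 + q) / 2 * (2 / (1 - q) * Z) := by
      field_simp; ring
    have h5 : q ^ (windowSize C β R s : ℕ) *
        (2 / (1 - q) * Z + ((1 + q) / (2 * q)) ^ (s.2 + 1)) ≤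
        q * (2 / (1 - q) * Z + ((1 + q) / (2 * q)) ^ (s.2 + 1)) :=
      mul_le_mul_of_nonneg_right hqq (by positivity)
    have h6 : (1 - q ^ (windowSize C β R s : ℕ)) * ((windowSize C β R s : ℕ) : ℝ) ≤
        (windowSize C β R s : ℕ) := by nlinarith
    have hMZ : 0 ≤ 2 / (1 - q) * Z := by positivity
    have h7 : (1 + q) / 2 * (2 / (1 - q) * Z) ≤ (3 + q) / 4 * (2 / (1 - q) * Z) :=
      mul_le_mul_of_nonneg_right (by linarith) hMZ
    rw [hl] at hm ⊢
    linarith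

end

/-! ### Accessibility, and attraction for the two chains -/

lemma evolve_ne_zero_of_step {S : Type*} [MeasurableSpace S] [Countable S]
    [MeasurableSingletonClass S] {K : Kernel S S} [IsMarkovKernel K] {x y a : S}
    (hxy : K x {y} ≠ 0) {n : ℕ} (hy : evolve K n (Measure.dirac y) {a} ≠ 0) :
    evolve K (n + 1) (Measure.dirac x) {a} ≠ 0 := by
  rw [evolve_succ', Measure.dirac_bind (Kernel.measurable _), evolve_apply]
  refine ne_of_gt (lt_of_lt_of_le (pos_iff_ne_zero.2 (mul_ne_zero hy hxy)) ?_)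
  calc _ = ∫⁻ z in {y}, evolve K n (Measure.dirac z) {a} ∂K x := by
        rw [lintegral_singleton]
    _ ≤ _ := setLIntegral_le_lintegral _ _

/-- The state just after a loss in a window of one packet. -/
def unitState : State := (⟨1, le_rfl⟩, 0)

section Chain

variable {C β R : ℝ} (hC : 0 < C) (hβ0 : 0 < β) (hβ1 : β < 1) (hR : 0 < R)
    {p : unitInterval} (hp0 : 0 < p) (hp1 : p < 1)

include hC hβ0 hβ1

omit hβ1 in
lemma windowSize_unitState : windowSize C β R unitState = ⟨1, le_rfl⟩ := by
  refine Subtype.ext ?_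
  have h : ⌊(1 - β) * ((1 : ℕ) : ℝ)⌋₊ = 0 := Nat.floor_eq_zero.2 (by push_cast; linarith)
  rw [unitState, windowSize_loss hC hβ0, h]
  rfl

lemma windowSize_lt {z : Window} (hz : 1 < (z : ℕ)) :
    (windowSize C β R (z, 0) : ℕ) < z := by
  rw [windowSize_loss hC hβ0]
  refine max_lt hz ?_
  have h0 : (0 : ℝ) < (z : ℕ) := by exact_mod_cast z.2
  rw [Nat.floor_lt (mul_nonneg (by linarith) h0.le)]
  nlinarith

/-- Repeated losses have positive probability and strictly reduce the window until it is one packet.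
-/
lemma unitState_accessible {K : Kernel State State} [IsMarkovKernel K]
    (hK : ∀ x, K x {(windowSize C β R x, 0)} ≠ 0) (x : State) :
    ∃ n, evolve K n (Measure.dirac x) {unitState} ≠ 0 := by
  have h : ∀ (m : ℕ) (z : Window), (z : ℕ) = m →
      ∃ n, evolve K n (Measure.dirac (z, 0)) {unitState} ≠ 0 := by
    intro m
    induction m using Nat.strong_induction_on with
    | _ m ih =>
      intro z hz
      rcases eq_or_lt_of_le z.2 with h1 | h1
      · have : (z, 0) = unitState := Prod.ext (Subtype.ext h1.symm) rfl
        exact ⟨0, by rw [evolve_zero, this]; simp⟩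
      · obtain ⟨n, hn⟩ := ih _ (hz ▸ windowSize_lt hC hβ0 hβ1 (R := R) h1) _ rfl
        exact ⟨n + 1, evolve_ne_zero_of_step (hK _) hn⟩
  obtain ⟨n, hn⟩ := h _ (windowSize C β R x) rfl
  exact ⟨n + 1, evolve_ne_zero_of_step (hK _) hn⟩

lemma exists_isAttracting_of_drift {K : Kernel State State} [IsMarkovKernel K]
    (hK : ∀ x, K x {(windowSize C β R x, 0)} ≠ 0) {q l : ℝ} {b : ℝ≥0∞} (hq0 : 0 < q)
    (hq1 : q < 1) (hl : l < 1) (hb : b ≠ ∞)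
    (hdrift : ∀ x, ∫⁻ y, ENNReal.ofReal (lyapunov q y) ∂K x ≤
      ENNReal.ofReal l * ENNReal.ofReal (lyapunov q x) + b) :
    ∃ π, IsAttracting K π := by
  refine exists_isAttracting (a := unitState) ?_ (unitState_accessible hC hβ0 hβ1 hK)
    (tightOrbit_of_drift (ENNReal.ofReal_lt_one.2 hl) hb (fun x => ENNReal.ofReal_ne_top) hdrift ?_)
  · have := hK unitState
    rwa [windowSize_unitState hC hβ0] at this
  · intro c hc
    refine (lyapunov_sublevel_finite hq0 hq1 c.toReal).subset ?_
    intro s hs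
    exact (ENNReal.ofReal_le_iff_le_toReal hc).1 hs

include hR hp0 hp1

lemma exists_stepKernel_drift :
    ∃ l b : ℝ, 0 ≤ l ∧ l < 1 ∧ 0 ≤ b ∧ ∀ x,
      ∫⁻ y, ENNReal.ofReal (lyapunov (1 - p) y) ∂stepKernel C β R p x ≤
        ENNReal.ofReal l * ENNReal.ofReal (lyapunov (1 - p) x) + ENNReal.ofReal b := by
  have hq0 : (0 : ℝ) < 1 - p := sub_pos.2 hp1
  have hq1 : (1 - p : ℝ) < 1 := sub_lt_self _ hp0
  obtain ⟨l, b, hl0, hl1, hb, h⟩ := lyapunov_drift hq0 hq1 hC hβ0 hβ1 hR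
  have hnn : ∀ x, 0 ≤ lyapunov (1 - p) x := fun x =>
    (Nat.cast_nonneg _).trans (le_lyapunov hq0 hq1 x)
  refine ⟨l, b, hl0, hl1, hb, fun x => ?_⟩
  have hw : 0 ≤ 1 - (1 - p : ℝ) ^ (windowSize C β R x : ℕ) :=
    sub_nonneg.2 (pow_le_one₀ hq0.le hq1.le)
  rw [lintegral_stepKernel, ← ENNReal.ofReal_mul (by positivity), ← ENNReal.ofReal_mul hw,
    ← ENNReal.ofReal_mul hl0, ← ENNReal.ofReal_add (mul_nonneg (by positivity) (hnn _))
      (mul_nonneg hw (hnn _)), ← ENNReal.ofReal_add (mul_nonneg hl0 (hnn _)) hb]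
  exact ENNReal.ofReal_le_ofReal (h x)

omit hC hβ0 hβ1 hR hp1 in
lemma stepKernel_loss_ne_zero (x : State) :
    stepKernel C β R p x {(windowSize C β R x, 0)} ≠ 0 :=
  ((ENNReal.ofReal_pos.2 hp0).trans_le (le_stepKernel_loss x)).ne'

lemma exists_isAttracting_stepKernel : ∃ π, IsAttracting (stepKernel C β R p) π := by
  obtain ⟨l, b, hl0, hl1, hb, h⟩ := exists_stepKernel_drift hC hβ0 hβ1 hR hp0 hp1
  exact exists_isAttracting_of_drift hC hβ0 hβ1 (stepKernel_loss_ne_zero hp0)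
    (sub_pos.2 hp1) (sub_lt_self _ hp0) hl1 ENNReal.ofReal_ne_top h

lemma exists_isAttracting_lossKernel :
    ∃ π, IsAttracting (firstLossKernel C β R p ∘ₖ stepKernel C β R p) π := by
  obtain ⟨l, b, hl0, hl1, hb, h⟩ := exists_stepKernel_drift hC hβ0 hβ1 hR hp0 hp1
  have hp0' : (0 : ℝ) < p := hp0
  have hp1' : (p : ℝ) < 1 := hp1
  set V : State → ℝ≥0∞ := fun x => ENNReal.ofReal (lyapunov (1 - p) x) with hV
  -- `B` solves `b + B * (1 - p) = B`: adding `B` away from loss states pays for the drift constant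
  -- `b` at each step before the next loss, so `g` is superharmonic there.
  set B : ℝ≥0∞ := ENNReal.ofReal (b / p) with hB
  have hBb : ENNReal.ofReal b + B * ENNReal.ofReal (1 - p) = B := by
    rw [hB, ← ENNReal.ofReal_mul (by positivity), ← ENNReal.ofReal_add hb
      (mul_nonneg (by positivity) (by linarith))]
    congr 1
    field_simp
    ring
  set g : State → ℝ≥0∞ := fun x => V x + Set.indicator {y | y.2 ≠ 0} (fun _ => B) x with hg
  have hint : ∀ x, ∫⁻ y, g y ∂stepKernel C β R p x =
      ∫⁻ y, V y ∂stepKernel C β R p x + B * stepKernel C β R p x {y | y.2 ≠ 0} := by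
    intro x
    rw [hg, lintegral_add_left .of_discrete, lintegral_indicator_const .of_discrete]
  have hfirst : ∀ x, ∫⁻ y, V y ∂firstLossKernel C β R p x ≤ g x := by
    refine lintegral_firstLossKernel_le hp0 V g (fun x _ => le_self_add) fun x hx => ?_
    rw [hint]
    have hgx : g x = V x + B := by simp [hg, hx]
    calc _ ≤ (ENNReal.ofReal l * V x + ENNReal.ofReal b) + B * ENNReal.ofReal (1 - p) := by
          gcongr
          · exact h x
          · exact stepKernel_noLoss_le x
      _ = ENNReal.ofReal l * V x + B := by rw [add_assoc, hBb]
      _ ≤ g x := by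
        rw [hgx]
        gcongr
        exact mul_le_of_le_one_left zero_le (ENNReal.ofReal_le_one.2 hl1.le)
  refine exists_isAttracting_of_drift (R := R) hC hβ0 hβ1 ?_ (sub_pos.2 hp1) (sub_lt_self _ hp0)
    hl1 (b := ENNReal.ofReal b + B) (ENNReal.add_ne_top.2 ⟨ENNReal.ofReal_ne_top,
      ENNReal.ofReal_ne_top⟩) fun x => ?_
  · intro x
    rw [Kernel.comp_apply' _ _ _ (measurableSet_singleton _)]
    refine ne_of_gt (lt_of_lt_of_le (pos_iff_ne_zero.2
      (stepKernel_loss_ne_zero (C := C) (β := β) (R := R) hp0 x)) ?_)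
    calc _ = ∫⁻ y in {(windowSize C β R x, 0)},
          firstLossKernel C β R p y {(windowSize C β R x, 0)} ∂stepKernel C β R p x := by
          rw [lintegral_singleton, firstLossKernel_of_eq_zero rfl]
          simp
      _ ≤ _ := setLIntegral_le_lintegral _ _
  · rw [Kernel.lintegral_comp _ _ _ .of_discrete]
    calc _ ≤ ∫⁻ y, g y ∂stepKernel C β R p x := lintegral_mono hfirst
      _ ≤ (ENNReal.ofReal l * V x + ENNReal.ofReal b) + B := by
        rw [hint]
        gcongr
        · exact h x
        · exact mul_le_of_le_one_right zero_le prob_le_one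
      _ = _ := add_assoc _ _ _

end Chain

/-! ### From attracting laws to stationary distributions -/

section Stationary

variable {C β R : ℝ} {p : unitInterval}

lemma chainLaw_map_iterate {K : Kernel State State} [IsMarkovKernel K]
    {T : (ℕ → State) → ℕ → State} (hTm : Measurable T)
    (hT : ∀ μ : Measure State, IsProbabilityMeasure μ →
      (chainLaw C β R p μ).map T = chainLaw C β R p (K ∘ₘ μ))
    (n : ℕ) (μ : Measure State) [IsProbabilityMeasure μ] :
    (chainLaw C β R p μ).map T^[n] = chainLaw C β R p (evolve K n μ) := by
  induction n with
  | zero => rw [Function.iterate_zero, Measure.map_id, evolve_zero]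
  | succ n ih =>
    rw [Function.iterate_succ', ← Measure.map_map hTm (hTm.iterate n), ih, hT _ inferInstance,
      evolve_succ]

lemma chainLaw_map_le_add {E : Type*} [MeasurableSpace E] {Y : (ℕ → State) → E}
    (hY : Measurable Y) {μ π r : Measure State} (h : μ ≤ π + r) (s : Set E)
    (hs : MeasurableSet s) :
    (chainLaw C β R p μ).map Y s ≤ (chainLaw C β R p π).map Y s + r Set.univ := by
  have hmap : ∀ ν : Measure State,
      (chainLaw C β R p ν).map Y s = ∫⁻ x, pathKernel C β R p x (Y ⁻¹' s) ∂ν := fun ν => by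
    rw [Measure.map_apply hY hs, chainLaw_eq_comp, Measure.bind_apply (hY hs)
      (Kernel.aemeasurable _)]
  rw [hmap, hmap]
  calc _ ≤ ∫⁻ x, pathKernel C β R p x (Y ⁻¹' s) ∂(π + r) := lintegral_mono' h le_rfl
    _ = ∫⁻ x, pathKernel C β R p x (Y ⁻¹' s) ∂π + ∫⁻ x, pathKernel C β R p x (Y ⁻¹' s) ∂r :=
      lintegral_add_measure _ _ _
    _ ≤ ∫⁻ x, pathKernel C β R p x (Y ⁻¹' s) ∂π + ∫⁻ _, 1 ∂r := by
      gcongr; exact prob_le_one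
    _ = _ := by rw [lintegral_one]

/-- A process that reads off a functional of the path along the iterates of a path transformation
whose initial states form a chain with an attracting law has exactly one stationary
distribution. -/
lemma existsUnique_isStationaryDistribution {E : Type*} [MeasurableSpace E]
    {X : ℕ → (ℕ → State) → E} {Y : (ℕ → State) → E} (hY : Measurable Y)
    {T T₀ : (ℕ → State) → ℕ → State} (hTm : Measurable T) (hT₀m : Measurable T₀)
    {K L : Kernel State State} [IsMarkovKernel K] [IsMarkovKernel L] {π μ₀ : Measure State}
    (hπ : IsAttracting K π) (hμ₀ : IsProbabilityMeasure μ₀) (hLμ₀ : L ∘ₘ μ₀ = π)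
    (hT : ∀ μ : Measure State, IsProbabilityMeasure μ →
      (chainLaw C β R p μ).map T = chainLaw C β R p (K ∘ₘ μ))
    (hT₀ : ∀ μ : Measure State, IsProbabilityMeasure μ →
      (chainLaw C β R p μ).map T₀ = chainLaw C β R p (L ∘ₘ μ))
    (hX : ∀ μ : Measure State, IsProbabilityMeasure μ →
      ∀ᵐ ω ∂chainLaw C β R p μ, ∀ k, X k ω = Y (T^[k] (T₀ ω))) :
    ∃! ρ : Measure E, IsStationaryDistribution C β R p X ρ := by
  have := hπ.isProbabilityMeasure
  have hlaw : ∀ (μ : Measure State) [IsProbabilityMeasure μ] (k : ℕ),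
      (chainLaw C β R p μ).map (fun ω => T^[k] (T₀ ω)) =
        chainLaw C β R p (evolve K k (L ∘ₘ μ)) := by
    intro μ _ k
    rw [← chainLaw_map_iterate hTm hT, ← hT₀ μ inferInstance,
      Measure.map_map (hTm.iterate k) hT₀m]
    rfl
  have hXlaw : ∀ (μ : Measure State) [IsProbabilityMeasure μ] (k : ℕ),
      (chainLaw C β R p μ).map (X k) =
        (chainLaw C β R p (evolve K k (L ∘ₘ μ))).map Y := by
    intro μ _ k
    have hk : X k =ᵐ[chainLaw C β R p μ] Y ∘ fun ω => T^[k] (T₀ ω) := by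
      filter_upwards [hX μ inferInstance] with ω hω using hω k
    rw [Measure.map_congr hk, ← hlaw, Measure.map_map hY
      (show Measurable fun ω => T^[k] (T₀ ω) from (hTm.iterate k).comp hT₀m)]
  refine ⟨(chainLaw C β R p π).map Y, ⟨μ₀, hμ₀, fun m => ?_, fun k => ?_⟩, ?_⟩
  · have hΦ : Measurable fun (ω : ℕ → State) (n : ℕ) => Y (T^[n] ω) :=
      measurable_pi_lambda _ fun n => hY.comp (hTm.iterate n)
    have hae : ∀ m : ℕ, (fun ω n => X (n + m) ω) =ᵐ[chainLaw C β R p μ₀]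
        (fun (ω : ℕ → State) (n : ℕ) => Y (T^[n] ω)) ∘ fun ω => T^[m] (T₀ ω) := by
      intro m
      filter_upwards [hX μ₀ hμ₀] with ω hω
      funext n
      rw [hω, Function.iterate_add_apply]
      rfl
    have hmeas : ∀ m : ℕ, Measurable fun ω => T^[m] (T₀ ω) := fun m =>
      (hTm.iterate m).comp hT₀m
    have hmap : ∀ m : ℕ, (chainLaw C β R p μ₀).map (fun ω n => X (n + m) ω) =
        (chainLaw C β R p π).map (fun (ω : ℕ → State) (n : ℕ) => Y (T^[n] ω)) := by
      intro m
      rw [Measure.map_congr (hae m), ← Measure.map_map hΦ (hmeas m), hlaw, hLμ₀,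
        evolve_invariant hπ.invariant]
    exact ⟨(hΦ.comp (hmeas m)).aemeasurable.congr (hae m).symm,
      (hΦ.comp (hmeas 0)).aemeasurable.congr (hae 0).symm, (hmap m).trans (hmap 0).symm⟩
  · rw [hXlaw, hLμ₀, evolve_invariant hπ.invariant]
  · rintro ρ ⟨μ, hμ, -, hρ⟩
    have hP : IsProbabilityMeasure ρ := by
      rw [← hρ 0, hXlaw]
      exact Measure.isProbabilityMeasure_map hY.aemeasurable
    have hQ : IsProbabilityMeasure ((chainLaw C β R p π).map Y) :=
      Measure.isProbabilityMeasure_map hY.aemeasurable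
    refine Measure.eq_of_le_of_isProbabilityMeasure (Measure.le_iff.2 fun s hs => ?_)
    refine ENNReal.le_of_forall_pos_le_add fun δ hδ _ => ?_
    -- `ρ` is the marginal law at every time, so it may be read at a time `n` when the chain is
    -- within `δ` of `π`.
    obtain ⟨n, r, hr, h⟩ := hπ.exists_evolve_le (L ∘ₘ μ) inferInstance δ
      (by exact_mod_cast hδ.ne')
    rw [← hρ n, hXlaw]
    exact (chainLaw_map_le_add hY h s hs).trans (by gcongr)

lemma ae_forall_exists_loss (hp0 : 0 < p) (μ : Measure State) [IsProbabilityMeasure μ] :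
    ∀ᵐ ω ∂chainLaw C β R p μ, ∀ n, ∃ i, n ≤ i ∧ (ω i).2 = 0 := by
  refine ae_all_iff.2 fun n => ?_
  have h := chainLaw_map_iterate (C := C) (β := β) (R := R) (p := p) measurable_pathShift
    (fun μ _ => chainLaw_map_shift) n μ
  have h2 : ∀ᵐ ω ∂(chainLaw C β R p μ).map pathShift^[n], ∃ i, (ω i).2 = 0 := by
    rw [h]; exact ae_exists_loss hp0
  have hiter : ∀ (n : ℕ) (ω : ℕ → State) i, pathShift^[n] ω i = ω (i + n) := by
    intro n
    induction n with
    | zero => intro ω i; rfl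
    | succ n ih => intro ω i; rw [Function.iterate_succ_apply, ih]; exact congrArg ω (by omega)
  filter_upwards [ae_of_ae_map (measurable_pathShift.iterate n).aemeasurable h2] with ω ⟨i, hi⟩
  exact ⟨i + n, by omega, by rwa [hiter] at hi⟩

/-- The path from the `k`-th loss on begins at a loss; shifting it once, at the cost of the summand
`1`, excludes that loss from the search for the next. -/
lemma lossEpoch_succ {ω : ℕ → State} (hω : ∀ n, ∃ i, n ≤ i ∧ (ω i).2 = 0) (k : ℕ) :
    lossEpoch (k + 1) ω =
      lossEpoch k ω + (1 + lossEpoch 0 (pathShift fun n => ω (n + lossEpoch k ω))) := by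
  have hinf : (Set.ofPred fun n => (ω n).2 = 0).Infinite := by
    refine Set.infinite_of_forall_exists_gt fun n => ?_
    obtain ⟨i, hi, h⟩ := hω (n + 1)
    exact ⟨i, h, hi⟩
  set j := lossEpoch 0 (pathShift fun n => ω (n + lossEpoch k ω)) with hj
  have hj' : j = sInf {i | ((pathShift fun n => ω (n + lossEpoch k ω)) i).2 = 0} := by
    rw [hj, lossEpoch, Nat.nth_zero]
  have hlt : lossEpoch k ω < lossEpoch (k + 1) ω :=
    Nat.nth_strictMono hinf (Nat.lt_succ_self k)
  have hmem : (ω (lossEpoch (k + 1) ω)).2 = 0 := Nat.nth_mem_of_infinite hinf (k + 1)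
  have hmem' : lossEpoch (k + 1) ω - lossEpoch k ω - 1 ∈
      {i | ((pathShift fun n => ω (n + lossEpoch k ω)) i).2 = 0} := by
    change (ω (lossEpoch (k + 1) ω - lossEpoch k ω - 1 + 1 + lossEpoch k ω)).2 = 0
    rwa [show lossEpoch (k + 1) ω - lossEpoch k ω - 1 + 1 + lossEpoch k ω =
      lossEpoch (k + 1) ω by omega]
  have h1 : j ≤ lossEpoch (k + 1) ω - lossEpoch k ω - 1 := hj' ▸ Nat.sInf_le hmem'
  have h2 : (ω (j + 1 + lossEpoch k ω)).2 = 0 := by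
    have := Nat.sInf_mem ⟨_, hmem'⟩
    rw [← hj'] at this
    exact this
  have h3 : lossEpoch (k + 1) ω ≤ j + 1 + lossEpoch k ω := by
    by_contra! hcon
    have := Nat.le_nth_of_lt_nth_succ (p := fun n => (ω n).2 = 0) hcon h2
    change _ ≤ lossEpoch k ω at this
    omega
  omega

lemma iterate_fromFirstLoss {ω : ℕ → State} (hω : ∀ n, ∃ i, n ≤ i ∧ (ω i).2 = 0) (k : ℕ) :
    (fun ω => fromFirstLoss (pathShift ω))^[k] (fromFirstLoss ω) =
      fun n => ω (n + lossEpoch k ω) := by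
  induction k with
  | zero => rfl
  | succ k ih =>
    rw [Function.iterate_succ_apply', ih]
    funext n
    rw [lossEpoch_succ hω]
    simp only [fromFirstLoss, pathShift]
    exact congrArg ω (by omega)

end Stationary

theorem mainTheorem7 (C β R : ℝ) (hC : 0 < C) (hβ0 : 0 < β) (hβ1 : β < 1) (hR : 0 < R)
    (p : unitInterval) (hp0 : 0 < p) (hp1 : p < 1) :
    (∃! π : Measure Window, IsStationaryDistribution C β R p (rttWindow C β R) π) ∧
    (∃! π : Measure Window, IsStationaryDistribution C β R p (lossWindow C β R) π) ∧
    (∃! π : Measure ℕ, IsStationaryDistribution C β R p interLossTime π) := by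
  obtain ⟨π, hπ⟩ := exists_isAttracting_stepKernel hC hβ0 hβ1 hR hp0 hp1
  obtain ⟨π', hπ'⟩ := exists_isAttracting_lossKernel hC hβ0 hβ1 hR hp0 hp1
  have := hπ'.isProbabilityMeasure
  have hY : Measurable fun ω : ℕ → State => windowSize C β R (ω 0) :=
    (Measurable.of_discrete (f := windowSize C β R)).comp (measurable_pi_apply 0)
  have hT : ∀ μ : Measure State, IsProbabilityMeasure μ →
      (chainLaw C β R p μ).map (fun ω => fromFirstLoss (pathShift ω)) =
        chainLaw C β R p ((firstLossKernel C β R p ∘ₖ stepKernel C β R p) ∘ₘ μ) := by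
    intro μ _
    rw [← Measure.comp_assoc, ← chainLaw_map_fromFirstLoss hp0, ← chainLaw_map_shift,
      Measure.map_map measurable_fromFirstLoss measurable_pathShift]
    rfl
  have hTm := measurable_fromFirstLoss.comp measurable_pathShift
  -- Starting the chain one step after `π'` makes the state at its first loss have law `π'`,
  -- directly by invariance.
  have hμ₀ : firstLossKernel C β R p ∘ₘ (stepKernel C β R p ∘ₘ π') = π' := by
    rw [Measure.comp_assoc, hπ'.invariant]
  refine ⟨?_, ?_, ?_⟩
  · refine existsUnique_isStationaryDistribution (T₀ := id) (L := Kernel.id) hY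
      measurable_pathShift measurable_id hπ hπ.isProbabilityMeasure Measure.id_comp
      (fun μ _ => chainLaw_map_shift) (fun μ _ => by rw [Measure.map_id, Measure.id_comp])
      fun μ _ => Filter.Eventually.of_forall fun ω k => ?_
    have : pathShift^[k] ω 0 = ω k := by
      induction k generalizing ω with
      | zero => rfl
      | succ k ih => rw [Function.iterate_succ_apply, ih]; rfl
    rw [rttWindow, id, this]
  · refine existsUnique_isStationaryDistribution hY hTm measurable_fromFirstLoss hπ'
      inferInstance hμ₀ hT (fun μ _ => chainLaw_map_fromFirstLoss hp0) fun μ _ => ?_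
    filter_upwards [ae_forall_exists_loss hp0 μ] with ω hω k
    have h := iterate_fromFirstLoss hω k
    change _ = windowSize C β R ((fun ω => fromFirstLoss (pathShift ω))^[k] (fromFirstLoss ω) 0)
    rw [h]
    simp only [zero_add]
    rfl
  · refine existsUnique_isStationaryDistribution
      (Y := fun ω => 1 + lossEpoch 0 (pathShift ω))
      (measurable_const.add ((measurable_lossEpoch 0).comp measurable_pathShift)) hTm
      measurable_fromFirstLoss hπ' inferInstance hμ₀ hT
      (fun μ _ => chainLaw_map_fromFirstLoss hp0) fun μ _ => ?_
    filter_upwards [ae_forall_exists_loss hp0 μ] with ω hω k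
    have h := iterate_fromFirstLoss hω k
    change _ = 1 + lossEpoch 0 (pathShift
      ((fun ω => fromFirstLoss (pathShift ω))^[k] (fromFirstLoss ω)))
    rw [h, interLossTime, lossEpoch_succ hω, Nat.add_sub_cancel_left]
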